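/- Let $\mathfrak h$ be a separable complex Hilbert space (inner product linear in the second argument) with an anti-linear involution $J$ satisfying $\langle J\phi, J\psi\rangle=\langle\psi,\phi\rangle$ for all $\phi,\psi\in\mathfrak h$. Let $\Gamma(\mathfrak h)=\bigoplus_{n\ge 0}\mathfrak h^{\otimes_{\rm sym} n}$ be the bosonic Fock space, and let $\mathfrak F_A,\mathfrak F_B$ be two copies of it, with (closed, maximally defined) annihilation operators $A(\phi)$ on $\mathfrak F_A$ and $B(\phi)$ on $\mathfrak F_B$, given on the $(n+1)$-particle vectors by $\sqrt{n+1}$ times contraction of the first tensor factor with $\phi$; their Hilbert space adjoints are the creation operators. On the Hilbert space tensor product $\mathfrak F_A\otimes\mathfrak F_B$ define, for $\phi\in\mathfrak h$, $$Z(\phi)=A(\phi)\otimes I+I\otimes B(J\phi)^{*}$$ (algebraic tensor products of operators, with the natural domain of the sum). Then: 1. Each $Z(\phi)$ is densely defined and closable. 2. For all $\phi,\psi\in\mathfrak h$ and every $x$ in the algebraic tensor product of the finite-particle subspaces of $\mathfrak F_A$ and $\mathfrak F_B$, both $Z(\phi)Z(\psi)^{*}x$ and $Z(\psi)^{*}Z(\phi)x$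 are defined, and $[Z(\phi),Z(\psi)^{*}]x=0$. 3. The von Neumann algebra $\mathfrak Z=\{Z(\phi):\phi\in\mathfrak h\}''$ generated by the operators $Z(\phi)$ is commutative. Here $\{Z(\phi)\}'$ is the set of all bounded operators $T$ such that $T\,\overline{Z(\phi)}\subseteq\overline{Z(\phi)}\,T$ and $T^{*}\,\overline{Z(\phi)}\subseteq\overline{Z(\phi)}\,T^{*}$ for all $\phi\in\mathfrak h$, where the bar denotes the closure, and $\{Z(\phi)\}''$ is the commutant of that set in the bounded operators. -/

import Mathlib

open scoped TensorProduct InnerProductSpace ENNReal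

noncomputable section

universe u

/-! ### Bosonic Fock space -/

namespace BoseFock

/-- A complex inner product space, bundled so that tensor powers can be formed by recursion. -/
structure PreHilbert : Type (u + 1) where
  carrier : Type u
  [grp : NormedAddCommGroup carrier]
  [ips : InnerProductSpace ℂ carrier]

attribute [instance] PreHilbert.grp PreHilbert.ips

variable (h : Type u) [NormedAddCommGroup h] [InnerProductSpace ℂ h]

/-- The algebraic tensor powers `h ⊗ (h ⊗ (⋯ ⊗ ℂ))` with their inner products. The zeroth power
is one-dimensional (`ℂ`, put in the universe of `h`). -/
def tensorPow : ℕ → PreHilbert.{u}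
  | 0 => ⟨EuclideanSpace ℂ PUnit.{u + 1}⟩
  | n + 1 => ⟨h ⊗[ℂ] (tensorPow n).carrier⟩

/-- The algebraic `n`-th tensor power of `h`. -/
abbrev AlgPow (n : ℕ) : Type u := (tensorPow h n).carrier

/-- The Hilbert space tensor power `h ⊗ ⋯ ⊗ h` (`n` factors). -/
abbrev HilbertPow (n : ℕ) : Type u := UniformSpace.Completion (AlgPow h n)

variable {h}

/-- The elementary tensor `v₀ ⊗ ⋯ ⊗ vₙ₋₁`. -/
def elemTensor : (n : ℕ) → (Fin n → h) → AlgPow h n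
  | 0, _ => (EuclideanSpace.single PUnit.unit (1 : ℂ) : EuclideanSpace ℂ PUnit.{u + 1})
  | n + 1, v => (v 0 ⊗ₜ[ℂ] elemTensor n (fun i => v i.succ) : h ⊗[ℂ] AlgPow h n)

/-- The (unnormalised) symmetrisation `∑_σ v_{σ 0} ⊗ ⋯ ⊗ v_{σ (n-1)}` of an elementary tensor. -/
def symTensor (n : ℕ) (v : Fin n → h) : HilbertPow h n :=
  ∑ σ : Equiv.Perm (Fin n), ((elemTensor n (fun i => v (σ i)) : AlgPow h n) : HilbertPow h n)

variable (h) in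
/-- The symmetric `n`-particle space: the closed span of the symmetrised elementary tensors. -/
def symPow (n : ℕ) : Submodule ℂ (HilbertPow h n) :=
  (Submodule.span ℂ (Set.range (symTensor (h := h) n))).topologicalClosure

instance (n : ℕ) : CompleteSpace (symPow h n) :=
  Submodule.topologicalClosure.completeSpace _

variable (h) in
/-- The bosonic Fock space: the Hilbert sum over `n ≥ 0` of the symmetric tensor powers of `h`. -/
abbrev Fock : Type u := lp (fun n : ℕ => symPow h n) 2

/-- The contraction `ψ ⊗ t ↦ ⟨φ, ψ⟩ t` on algebraic tensor powers. -/
def algContract (φ : h) (n : ℕ) : AlgPow h (n + 1) →L[ℂ] AlgPow h n :=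
  ((TensorProduct.lidIsometry ℂ (AlgPow h n)).toContinuousLinearEquiv.toContinuousLinearMap ∘L
    TensorProduct.mapL (innerSL ℂ φ) (ContinuousLinearMap.id ℂ (AlgPow h n)) :
      h ⊗[ℂ] AlgPow h n →L[ℂ] AlgPow h n)

/-- The contraction `ψ ⊗ t ↦ ⟨φ, ψ⟩ t` on Hilbert tensor powers. -/
def contract (φ : h) (n : ℕ) : HilbertPow h (n + 1) →L[ℂ] HilbertPow h n :=
  (algContract φ n).completion

theorem algContract_elemTensor (φ : h) (n : ℕ) (v : Fin (n + 1) → h) :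
    algContract φ n (elemTensor (n + 1) v) = ⟪φ, v 0⟫_ℂ • elemTensor n (fun i => v i.succ) := by
  change TensorProduct.lid ℂ (AlgPow h n) (TensorProduct.mapL (innerSL ℂ φ)
    (ContinuousLinearMap.id ℂ (AlgPow h n)) (v 0 ⊗ₜ[ℂ] elemTensor n (fun i => v i.succ))) = _
  rw [TensorProduct.mapL_tmul]
  simp

theorem contract_coe (φ : h) (n : ℕ) (x : AlgPow h (n + 1)) :
    contract φ n (x : HilbertPow h (n + 1)) = ((algContract φ n x : AlgPow h n) : HilbertPow h n) :=
  UniformSpace.Completion.map_coe (algContract φ n).uniformContinuous x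

theorem contract_symTensor (φ : h) (n : ℕ) (v : Fin (n + 1) → h) :
    contract φ n (symTensor (n + 1) v) =
      ∑ p : Fin (n + 1), ⟪φ, v p⟫_ℂ • symTensor n (fun i => v (Equiv.swap 0 p i.succ)) := by
  unfold symTensor
  rw [map_sum, ← Equiv.sum_comp Equiv.Perm.decomposeFin.symm, Fintype.sum_prod_type]
  refine Finset.sum_congr rfl fun p _ => ?_
  rw [Finset.smul_sum]
  refine Finset.sum_congr rfl fun e _ => ?_
  rw [contract_coe, algContract_elemTensor, UniformSpace.Completion.coe_smul]
  simp only [Equiv.Perm.decomposeFin_symm_apply_zero, Equiv.Perm.decomposeFin_symm_apply_succ]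

theorem contract_mem_symPow (φ : h) (n : ℕ) {x : HilbertPow h (n + 1)}
    (hx : x ∈ symPow h (n + 1)) : contract φ n x ∈ symPow h n := by
  have key : Submodule.span ℂ (Set.range (symTensor (h := h) (n + 1))) ≤
      (symPow h n).comap (contract φ n).toLinearMap := by
    rw [Submodule.span_le]
    rintro _ ⟨v, rfl⟩
    change contract φ n (symTensor (n + 1) v) ∈ symPow h n
    rw [contract_symTensor]
    exact Submodule.sum_mem _ fun p _ => Submodule.smul_mem _ _
      (Submodule.le_topologicalClosure _ (Submodule.subset_span ⟨_, rfl⟩))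
  have hcl : IsClosed ((symPow h n).comap (contract φ n).toLinearMap : Set (HilbertPow h (n + 1))) :=
    (Submodule.isClosed_topologicalClosure _).preimage (contract φ n).continuous
  exact Submodule.topologicalClosure_minimal _ key hcl hx

/-- The contraction restricted to the symmetric subspaces. -/
def symContract (φ : h) (n : ℕ) : symPow h (n + 1) →L[ℂ] symPow h n :=
  ((contract φ n).comp (symPow h (n + 1)).subtypeL).codRestrict (symPow h n)
    fun x => contract_mem_symPow φ n x.2

/-- The sequence `(√(n+1) ⟨φ| Ψ_{n+1})_n`. -/
def annihilationSeq (φ : h) (Ψ : Fock h) (n : ℕ) : symPow h n :=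
  ((√((n : ℝ) + 1) : ℝ) : ℂ) • symContract φ n (Ψ (n + 1))

theorem annihilationSeq_zero (φ : h) : annihilationSeq φ (0 : Fock h) = 0 := by
  funext n
  simp [annihilationSeq]

theorem annihilationSeq_add (φ : h) (Ψ Φ : Fock h) :
    annihilationSeq φ (Ψ + Φ) = annihilationSeq φ Ψ + annihilationSeq φ Φ := by
  funext n
  simp only [annihilationSeq, lp.coeFn_add, Pi.add_apply, map_add, smul_add]

theorem annihilationSeq_smul (φ : h) (c : ℂ) (Ψ : Fock h) :
    annihilationSeq φ (c • Ψ) = c • annihilationSeq φ Ψ := by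
  funext n
  simp only [annihilationSeq, lp.coeFn_smul, Pi.smul_apply, map_smul]
  exact smul_comm _ _ _

/-- The annihilation operator `A(φ)` on Fock space, with its maximal domain:
`(A(φ) Ψ)_n = √(n+1) ⟨φ| Ψ_{n+1}`. -/
def annihilation (φ : h) : Fock h →ₗ.[ℂ] Fock h where
  domain :=
    { carrier := {Ψ | Memℓp (annihilationSeq φ Ψ) 2}
      zero_mem' := by
        rw [Set.mem_ofPred_eq, annihilationSeq_zero]
        exact zero_memℓp
      add_mem' := by
        intro Ψ Φ hΨ hΦ
        rw [Set.mem_ofPred_eq, annihilationSeq_add]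
        exact hΨ.add hΦ
      smul_mem' := by
        intro c Ψ hΨ
        rw [Set.mem_ofPred_eq, annihilationSeq_smul]
        exact hΨ.const_smul c }
  toFun :=
    { toFun := fun Ψ => ⟨annihilationSeq φ Ψ.1, Ψ.2⟩
      map_add' := fun Ψ Φ => Subtype.ext (annihilationSeq_add φ Ψ.1 Φ.1)
      map_smul' := fun c Ψ => Subtype.ext (annihilationSeq_smul φ c Ψ.1) }

/-- The creation operator `A(φ)*`: the Hilbert space adjoint of the annihilation operator. -/
def creation [CompleteSpace h] (φ : h) : Fock h →ₗ.[ℂ] Fock h := (annihilation φ).adjoint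

variable (h) in
/-- The finite-particle vectors of Fock space. -/
def finiteParticle : Submodule ℂ (Fock h) where
  carrier := {Ψ | (Function.support fun n : ℕ => ‖Ψ n‖).Finite}
  zero_mem' := by simp [Function.support]
  add_mem' := by
    intro Ψ Φ hΨ hΦ
    refine (Set.Finite.union hΨ hΦ).subset fun n hn => ?_
    by_contra hcon
    simp only [Set.mem_union, Function.mem_support, not_or, not_not, norm_eq_zero] at hcon
    exact hn (by simp [hcon.1, hcon.2])
  smul_mem' := by
    intro c Ψ hΨ
    refine Set.Finite.subset hΨ fun n hn hcon => hn ?_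
    simp only [norm_eq_zero] at hcon
    simp [hcon]

end BoseFock

/-! ### Tensor products of partially defined operators -/

section TensorOperators

variable {E F : Type*} [NormedAddCommGroup E] [InnerProductSpace ℂ E]
  [NormedAddCommGroup F] [InnerProductSpace ℂ F]

/-- The Hilbert space tensor product of `E` and `F`. -/
abbrev HilbertTensor (E F : Type*) [NormedAddCommGroup E] [InnerProductSpace ℂ E]
    [NormedAddCommGroup F] [InnerProductSpace ℂ F] : Type _ :=
  UniformSpace.Completion (E ⊗[ℂ] F)

/-- The inclusion of the algebraic tensor product of two subspaces in the Hilbert space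
tensor product. -/
def tensorIncl (p : Submodule ℂ E) (q : Submodule ℂ F) : (p ⊗[ℂ] q) →ₗ[ℂ] HilbertTensor E F :=
  (UniformSpace.Completion.toComplL (𝕜 := ℂ) (E := E ⊗[ℂ] F)).toLinearMap ∘ₗ
    TensorProduct.mapIncl p q

theorem tensorIncl_injective (p : Submodule ℂ E) (q : Submodule ℂ F) :
    Function.Injective (tensorIncl p q) := by
  intro x y hxy
  have hxy' : TensorProduct.mapIncl p q x = TensorProduct.mapIncl p q y :=
    UniformSpace.Completion.coe_injective (E ⊗[ℂ] F) hxy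
  apply (TensorProduct.mapInclIsometry p q).injective
  rw [TensorProduct.mapInclIsometry_apply, TensorProduct.mapInclIsometry_apply]
  exact hxy'

/-- The algebraic tensor product of two operators: its domain is the algebraic tensor product
of the domains, and it maps `x ⊗ y` to `S x ⊗ T y`. -/
def tensorOp (S : E →ₗ.[ℂ] E) (T : F →ₗ.[ℂ] F) :
    HilbertTensor E F →ₗ.[ℂ] HilbertTensor E F where
  domain := LinearMap.range (tensorIncl S.domain T.domain)
  toFun :=
    (UniformSpace.Completion.toComplL (𝕜 := ℂ) (E := E ⊗[ℂ] F)).toLinearMap ∘ₗ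
      TensorProduct.map S.toFun T.toFun ∘ₗ
      (LinearEquiv.ofInjective _ (tensorIncl_injective S.domain T.domain)).symm.toLinearMap

/-- The identity as an (everywhere defined) operator. -/
def idOp (E : Type*) [NormedAddCommGroup E] [InnerProductSpace ℂ E] : E →ₗ.[ℂ] E :=
  LinearMap.id.toPMap ⊤

end TensorOperators

/-! ### The von Neumann algebra generated by closed operators -/

section Generated

variable {H : Type*} [NormedAddCommGroup H] [InnerProductSpace ℂ H]

/-- `T N ⊆ N T` for a bounded operator `T` and a possibly unbounded operator `N`. -/
def CommutesWith (T : H →L[ℂ] H) (N : H →ₗ.[ℂ] H) : Prop :=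
  ∀ x : N.domain, ∃ hx : T x ∈ N.domain, N ⟨T x, hx⟩ = T (N x)

variable [CompleteSpace H]

/-- The commutant of a family of possibly unbounded operators: all bounded `T` such that both
`T` and `T*` commute with every member of the family. -/
def unboundedCommutant (𝒩 : Set (H →ₗ.[ℂ] H)) : Set (H →L[ℂ] H) :=
  {T | ∀ N ∈ 𝒩, CommutesWith T N ∧ CommutesWith (star T) N}

/-- The von Neumann algebra generated by a family of closed operators: its bicommutant. -/
def generatedVonNeumannAlgebra (𝒩 : Set (H →ₗ.[ℂ] H)) : VonNeumannAlgebra H where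
  carrier := Set.centralizer (unboundedCommutant 𝒩)
  mul_mem' := Set.mul_mem_centralizer
  one_mem' := Set.one_mem_centralizer
  add_mem' := Set.add_mem_centralizer
  zero_mem' := Set.zero_mem_centralizer
  algebraMap_mem' := fun c T _ => (Algebra.commutes c T).symm
  star_mem' := by
    intro S hS T hT
    have hT' : star T ∈ unboundedCommutant 𝒩 := fun N hN =>
      ⟨(hT N hN).2, by rw [star_star]; exact (hT N hN).1⟩
    have key := congrArg star (hS _ hT')
    simpa only [star_mul, star_star] using key.symm
  centralizer_centralizer' := Set.centralizer_centralizer_centralizer _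

end Generated

/-! ### The fields `Z(φ)` -/

namespace BoseFock

variable {h : Type u} [NormedAddCommGroup h] [InnerProductSpace ℂ h] [CompleteSpace h]

/-- The field `Z(φ) = A(φ) ⊗ I + I ⊗ B(J φ)*` on the tensor product of two copies of Fock space,
where `A` and `B` are the annihilation operators of the two copies. -/
def fieldZ (J : h →ₗ⋆[ℂ] h) (φ : h) :
    HilbertTensor (Fock h) (Fock h) →ₗ.[ℂ] HilbertTensor (Fock h) (Fock h) :=
  tensorOp (annihilation φ) (idOp (Fock h)) + tensorOp (idOp (Fock h)) (creation (J φ))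

/-- The von Neumann algebra generated by (the closures of) the fields `Z(φ)`, `φ ∈ h`. -/
def algebraZ (J : h →ₗ⋆[ℂ] h) : VonNeumannAlgebra (HilbertTensor (Fock h) (Fock h)) :=
  generatedVonNeumannAlgebra (Set.range fun φ : h => (fieldZ J φ).closure)

variable (h) in
/-- The algebraic tensor product of the finite-particle spaces of the two copies. -/
def finiteParticle₂ : Submodule ℂ (HilbertTensor (Fock h) (Fock h)) :=
  LinearMap.range (tensorIncl (finiteParticle h) (finiteParticle h))

end BoseFock

end

/-! On finite-particle vectors the adjoint of Z(ψ) acts as A(ψ)* ⊗ I + I ⊗ B(Jψ). The canonical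
commutation relations therefore give [Z(φ), Z(ψ)*] = ⟨φ,ψ⟩ − ⟨Jψ,Jφ⟩, and the two terms cancel
because J is antiunitary (`algField_comm_adjoint`). Commutation on a dense domain does not by itself
imply that the generated von Neumann algebra is commutative, so the rest is analysis.

The analytic tool is a sequence of cutoffs F_k = w_k ⊗ w_k, where w_k multiplies the n-particle
component by (k+1)/(n+k+1). A ladder operator X grows like √n, so X F_k is bounded and [F_k, X] =
F_k K_k with ‖K_k‖ = O(k^(-1/2)). As with Friedrichs mollifiers, the weak extension then equals the
strong one (`weakGraph_subset_closure`). Hence the closure of Z(φ) is the adjoint of its formal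
adjoint on the core (`HasRegularCore.closure_graph`), and the hermitian fields θZ + θ̄Z* are
essentially self-adjoint, with bounded resolvents (`exists_resolvent`).

If two such fields commute on the core, the smallness of K_k shows that the resolvent of one
preserves the closed graph of the other (`resolvent_mem_weakGraph`), so the resolvents commute. Let
W be the set of all these resolvents. Everything in W' commutes with the closures of the Z(φ), so
the generated algebra lies in W'', which is abelian because W is a commuting set. -/

noncomputable section

/-! ### Formally adjoint operators and their weak graphs -/

namespace WeakGraph

open Filter Topology

variable {V H : Type*} [NormedAddCommGroup V] [InnerProductSpace ℂ V]
  [NormedAddCommGroup H] [InnerProductSpace ℂ H]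

/-- The graph of the Hilbert space adjoint of `X'`, where `X'` acts on a dense subspace. -/
def weakGraph (ι : V →ₗᵢ[ℂ] H) (X' : V →ₗ[ℂ] V) : Submodule ℂ (H × H) where
  carrier := {p | ∀ d, ⟪p.1, ι (X' d)⟫_ℂ = ⟪p.2, ι d⟫_ℂ}
  zero_mem' := by intro d; simp
  add_mem' := by
    intro p q hp hq d
    simp only [Prod.fst_add, Prod.snd_add, inner_add_left, hp d, hq d]
  smul_mem' := by
    intro c p hp d
    simp only [Prod.smul_fst, Prod.smul_snd, inner_smul_left, hp d]

theorem mem_weakGraph {ι : V →ₗᵢ[ℂ] H} {X' : V →ₗ[ℂ] V} {p : H × H} :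
    p ∈ weakGraph ι X' ↔ ∀ d, ⟪p.1, ι (X' d)⟫_ℂ = ⟪p.2, ι d⟫_ℂ := Iff.rfl

theorem isClosed_weakGraph (ι : V →ₗᵢ[ℂ] H) (X' : V →ₗ[ℂ] V) :
    IsClosed (weakGraph ι X' : Set (H × H)) := by
  have : (weakGraph ι X' : Set (H × H)) = ⋂ d, {p : H × H | ⟪p.1, ι (X' d)⟫_ℂ = ⟪p.2, ι d⟫_ℂ} := by
    ext p
    simp [mem_weakGraph]
  rw [this]
  refine isClosed_iInter fun d => isClosed_eq ?_ ?_ <;> fun_prop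

/-- The graph of an operator on a dense subspace, seen in the Hilbert space. -/
def strongGraph (ι : V →ₗᵢ[ℂ] H) (X : V →ₗ[ℂ] V) : Set (H × H) :=
  Set.range fun d => (ι d, ι (X d))

/-- `X` and `X'` are formal adjoints of one another. -/
def FormalAdjoint (X X' : V →ₗ[ℂ] V) : Prop := ∀ x y, ⟪X x, y⟫_ℂ = ⟪x, X' y⟫_ℂ

theorem FormalAdjoint.symm {X X' : V →ₗ[ℂ] V} (hX : FormalAdjoint X X') : FormalAdjoint X' X := by
  intro x y
  rw [← inner_conj_symm, ← hX y x, inner_conj_symm]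

theorem FormalAdjoint.add {X X' Y Y' : V →ₗ[ℂ] V} (hX : FormalAdjoint X X')
    (hY : FormalAdjoint Y Y') : FormalAdjoint (X + Y) (X' + Y') := by
  intro x y
  simp only [LinearMap.add_apply, inner_add_left, inner_add_right, hX x y, hY x y]

theorem FormalAdjoint.smul {X X' : V →ₗ[ℂ] V} (hX : FormalAdjoint X X') (c : ℂ) :
    FormalAdjoint (c • X) (star c • X') := by
  intro x y
  simp only [LinearMap.smul_apply, inner_smul_left, inner_smul_right, hX x y, RCLike.star_def]

theorem FormalAdjoint.mem_weakGraph {ι : V →ₗᵢ[ℂ] H} {X X' : V →ₗ[ℂ] V} (hX : FormalAdjoint X X')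
    (d : V) : (ι d, ι (X d)) ∈ weakGraph ι X' := by
  intro e
  simp only [LinearIsometry.inner_map_map, hX d e]

/-- Symmetric contractions, converging strongly to the identity, that serve as cutoffs. -/
structure IsCutoff (F : ℕ → V →L[ℂ] V) : Prop where
  norm_le : ∀ k, ‖F k‖ ≤ 1
  symmetric : ∀ k x y, ⟪F k x, y⟫_ℂ = ⟪x, F k y⟫_ℂ
  tendsto : ∀ x, Tendsto (fun k => F k x) atTop (𝓝 x)
  surjective : ∀ k, Function.Surjective (F k)

/-- An operator that becomes bounded after a cutoff, and whose commutators with the cutoffs are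
small. -/
def IsRegular (F : ℕ → V →L[ℂ] V) (X : V →ₗ[ℂ] V) : Prop :=
  (∀ k, ∃ B : V →L[ℂ] V, ∀ x, X (F k x) = B x) ∧
  ∃ K : ℕ → V →L[ℂ] V, (∀ k x, F k (X x) - X (F k x) = F k (K k x)) ∧
    Tendsto (fun k => ‖K k‖) atTop (𝓝 0)

theorem IsRegular.add {F : ℕ → V →L[ℂ] V} {X Y : V →ₗ[ℂ] V} (hX : IsRegular F X)
    (hY : IsRegular F Y) : IsRegular F (X + Y) := by
  obtain ⟨hX₁, K, hK, hK₀⟩ := hX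
  obtain ⟨hY₁, L, hL, hL₀⟩ := hY
  refine ⟨fun k => ?_, fun k => K k + L k, fun k x => ?_, ?_⟩
  · obtain ⟨B, hB⟩ := hX₁ k
    obtain ⟨C, hC⟩ := hY₁ k
    exact ⟨B + C, fun x => by simp [hB, hC]⟩
  · simp only [LinearMap.add_apply, map_add, add_apply, ← hK, ← hL]
    abel
  · refine squeeze_zero (fun k => norm_nonneg _) (fun k => norm_add_le _ _) ?_
    simpa using hK₀.add hL₀

theorem IsRegular.smul {F : ℕ → V →L[ℂ] V} {X : V →ₗ[ℂ] V} (hX : IsRegular F X) (c : ℂ) :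
    IsRegular F (c • X) := by
  obtain ⟨hX₁, K, hK, hK₀⟩ := hX
  refine ⟨fun k => ?_, fun k => c • K k, fun k x => ?_, ?_⟩
  · obtain ⟨B, hB⟩ := hX₁ k
    exact ⟨c • B, fun x => by simp [hB]⟩
  · simp only [LinearMap.smul_apply, map_smul, smul_apply, ← hK, smul_sub]
  · simpa [norm_smul] using hK₀.const_mul ‖c‖

theorem eq_of_inner_dense {ι : V →ₗᵢ[ℂ] H} (hι : DenseRange ι) {v w : H}
    (hvw : ∀ d, ⟪v, ι d⟫_ℂ = ⟪w, ι d⟫_ℂ) : v = w :=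
  hι.eq_of_inner_left (𝕜 := ℂ) hvw

theorem norm_le_of_inner_dense {ι : V →ₗᵢ[ℂ] H} (hι : DenseRange ι) {v : H} {C : ℝ}
    (hC : 0 ≤ C) (hv : ∀ d, ‖⟪v, ι d⟫_ℂ‖ ≤ C * ‖d‖) : ‖v‖ ≤ C := by
  have h1 : ∀ z, ‖⟪v, z⟫_ℂ‖ ≤ C * ‖z‖ := by
    refine isClosed_property hι (isClosed_le (by fun_prop) (by fun_prop)) fun d => ?_
    simpa using hv d
  rcases eq_or_ne v 0 with rfl | h0
  · simpa using hC
  · have h2 := h1 v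
    rw [inner_self_eq_norm_sq_to_K, norm_pow, RCLike.norm_ofReal, abs_norm, sq] at h2
    exact le_of_mul_le_mul_right h2 (norm_pos_iff.2 h0)

variable [CompleteSpace H]

theorem exists_extension {ι : V →ₗᵢ[ℂ] H} (hι : DenseRange ι) (T : V →L[ℂ] V) :
    ∃ S : H →L[ℂ] H, (∀ x, S (ι x) = ι (T x)) ∧ ‖S‖ ≤ ‖T‖ := by
  refine ⟨(ι.toContinuousLinearMap ∘L T).extend ι.toContinuousLinearMap, fun x => ?_, ?_⟩
  · exact ContinuousLinearMap.extend_eq _ (e := ι.toContinuousLinearMap) hι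
      ι.isometry.isUniformInducing x
  · refine (ContinuousLinearMap.opNorm_extend_le _ (N := 1) (e := ι.toContinuousLinearMap) hι
      (fun x => by simp)).trans ?_
    rw [NNReal.coe_one, one_mul]
    refine ContinuousLinearMap.opNorm_le_bound _ (norm_nonneg _) fun x => ?_
    simpa using T.le_opNorm x

/-- For regular formal adjoints the weak graph is the closure of the strong one. -/
theorem weakGraph_subset_closure {ι : V →ₗᵢ[ℂ] H} (hι : DenseRange ι) {F : ℕ → V →L[ℂ] V}
    (hF : IsCutoff F) {X X' : V →ₗ[ℂ] V} (hXX' : FormalAdjoint X X') (hX : IsRegular F X)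
    (hX' : IsRegular F X') : (weakGraph ι X' : Set (H × H)) ⊆ closure (strongGraph ι X) := by
  rintro ⟨y, w⟩ hyw
  obtain ⟨K, hK, hK₀⟩ := hX'.2
  choose B hB using hX.1
  choose Fe hFe hFe₁ using fun k => exists_extension hι (F k)
  choose Be hBe _ using fun k => exists_extension hι (B k)
  have hFe_sym : ∀ k v d, ⟪Fe k v, ι d⟫_ℂ = ⟪v, ι (F k d)⟫_ℂ := by
    intro k v d
    refine isClosed_property hι (p := fun v => ⟪Fe k v, ι d⟫_ℂ = ⟪v, ι (F k d)⟫_ℂ)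
      (isClosed_eq (by fun_prop) (by fun_prop)) (fun x => ?_) v
    simp only [hFe, LinearIsometry.inner_map_map, hF.symmetric]
  have hBe_adj : ∀ k v d, ⟪Be k v, ι d⟫_ℂ = ⟪v, ι (F k (X' d))⟫_ℂ := by
    intro k v d
    refine isClosed_property hι (p := fun v => ⟪Be k v, ι d⟫_ℂ = ⟪v, ι (F k (X' d))⟫_ℂ)
      (isClosed_eq (by fun_prop) (by fun_prop)) (fun x => ?_) v
    simp only [hBe, ← hB, LinearIsometry.inner_map_map, ← hF.symmetric, hXX' _ d]
  have hFt : ∀ v, Tendsto (fun k => Fe k v) atTop (𝓝 v) := by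
    intro v
    rw [Metric.tendsto_atTop]
    intro ε hε
    obtain ⟨d, hd⟩ := hι.exists_dist_lt v (show (0 : ℝ) < ε / 3 by positivity)
    obtain ⟨N, hN⟩ := Metric.tendsto_atTop.1 (hF.tendsto d) (ε / 3) (by positivity)
    refine ⟨N, fun n hn => ?_⟩
    have h1 : dist (Fe n v) (Fe n (ι d)) ≤ dist v (ι d) := by
      rw [dist_eq_norm, ← map_sub, dist_eq_norm]
      exact (Fe n).le_of_opNorm_le ((hFe₁ n).trans (hF.norm_le n)) _ |>.trans (by simp)
    have h2 : dist (Fe n (ι d)) (ι d) < ε / 3 := by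
      rw [hFe, ι.dist_map]
      exact hN n hn
    have h3 := dist_triangle4 (Fe n v) (Fe n (ι d)) (ι d) v
    rw [dist_comm (ι d) v] at h3
    linarith
  -- For y in the core this pair is (F_k y, X F_k y). Since X F_k is bounded, density extends the
  -- membership to every y in the Hilbert space.
  have hmem : ∀ k, (Fe k y, Be k y) ∈ closure (strongGraph ι X) := by
    intro k
    refine isClosed_property hι (p := fun y => (Fe k y, Be k y) ∈ closure (strongGraph ι X))
      (isClosed_closure.preimage (by fun_prop)) (fun x => ?_) y
    exact subset_closure ⟨F k x, by simp [hFe, hBe, hB]⟩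
  -- Tested against d, the defect is y paired with [F_k, X'] d = F_k K_k d. The estimate uses only
  -- the norm of y, which need not lie in the core.
  have hdiff : ∀ k, ‖Be k y - Fe k w‖ ≤ ‖y‖ * ‖K k‖ := by
    intro k
    refine norm_le_of_inner_dense hι (by positivity) fun d => ?_
    have : ⟪Be k y - Fe k w, ι d⟫_ℂ = ⟪y, ι (F k (K k d))⟫_ℂ := by
      rw [inner_sub_left, hBe_adj, hFe_sym, ← hyw (F k d), ← inner_sub_right, ← map_sub, hK]
    rw [this, mul_assoc]
    refine (norm_inner_le_norm _ _).trans (mul_le_mul_of_nonneg_left ?_ (norm_nonneg _))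
    rw [ι.norm_map]
    refine ((F k).le_of_opNorm_le (hF.norm_le k) _).trans ?_
    rw [one_mul]
    exact (K k).le_opNorm d
  have hBt : Tendsto (fun k => Be k y) atTop (𝓝 w) := by
    have h0 : Tendsto (fun k => Be k y - Fe k w) atTop (𝓝 0) :=
      squeeze_zero_norm hdiff (by simpa using hK₀.const_mul ‖y‖)
    simpa using h0.add (hFt w)
  exact isClosed_closure.mem_of_tendsto ((hFt y).prodMk_nhds hBt) (Eventually.of_forall hmem)

/-! ### Essential self-adjointness, resolvents and strong commutation. -/

section Symmetric

variable {ι : V →ₗᵢ[ℂ] H} {F : ℕ → V →L[ℂ] V} {X : V →ₗ[ℂ] V}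

/-- The weak graph is that of the adjoint, which need not be symmetric in general. Since weak equals
strong here, `q` may be approximated by core vectors, and for those the identity is what membership
of `p` means. -/
theorem inner_symm_of_mem_weakGraph (hι : DenseRange ι) (hF : IsCutoff F)
    (hsym : FormalAdjoint X X) (hX : IsRegular F X) {p q : H × H} (hp : p ∈ weakGraph ι X)
    (hq : q ∈ weakGraph ι X) : ⟪p.1, q.2⟫_ℂ = ⟪p.2, q.1⟫_ℂ := by
  have hq' := weakGraph_subset_closure hι hF hsym hX hX hq
  refine closure_minimal (s := strongGraph ι X) (t := {q | ⟪p.1, q.2⟫_ℂ = ⟪p.2, q.1⟫_ℂ})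
    ?_ (isClosed_eq (by fun_prop) (by fun_prop)) hq'
  rintro _ ⟨d, rfl⟩
  exact hp d

/-- The cross term vanishes because ⟨Xy, y⟩ is real and `c` is imaginary. The sign +i gives the
lower bound for X + i, and −i excludes a deficiency vector. -/
theorem norm_sq_add_smul (hι : DenseRange ι) (hF : IsCutoff F)
    (hsym : FormalAdjoint X X) (hX : IsRegular F X) {p : H × H} (hp : p ∈ weakGraph ι X)
    {c : ℂ} (hc : c = Complex.I ∨ c = -Complex.I) :
    ‖p.2 + c • p.1‖ ^ 2 = ‖p.2‖ ^ 2 + ‖p.1‖ ^ 2 := by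
  have h1 := inner_symm_of_mem_weakGraph hι hF hsym hX hp hp
  have h2 : (starRingEnd ℂ) ⟪p.2, p.1⟫_ℂ = ⟪p.2, p.1⟫_ℂ := by rw [inner_conj_symm, h1]
  have h3 : (⟪p.2, p.1⟫_ℂ).im = 0 := Complex.conj_eq_iff_im.1 h2
  rw [@norm_add_sq ℂ, inner_smul_right, norm_smul]
  rcases hc with rfl | rfl <;> simp [h3]

/-- The basic criterion for self-adjointness: X + i is bounded below on a closed graph, so its range
is closed. A vector z orthogonal to the range satisfies Xz = iz weakly, which forces z = 0 by the
norm identity for X − i. -/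
theorem exists_resolvent (hι : DenseRange ι) (hF : IsCutoff F)
    (hsym : FormalAdjoint X X) (hX : IsRegular F X) :
    ∃ R : H →L[ℂ] H, (∀ x, (R x, x - Complex.I • R x) ∈ weakGraph ι X) ∧
      ∀ p ∈ weakGraph ι X, R (p.2 + Complex.I • p.1) = p.1 := by
  have hnorm := fun (p : weakGraph ι X) =>
    norm_sq_add_smul hι hF hsym hX p.2 (c := Complex.I) (Or.inl rfl)
  let m : weakGraph ι X →L[ℂ] H :=
    (ContinuousLinearMap.snd ℂ H H + Complex.I • ContinuousLinearMap.fst ℂ H H) ∘L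
      (weakGraph ι X).subtypeL
  have hm : ∀ p : weakGraph ι X, m p = p.1.2 + Complex.I • p.1.1 := fun p => rfl
  have hb1 : ∀ p, ‖p.1.1‖ ≤ ‖m p‖ := fun p =>
    abs_le_of_sq_le_sq' (by rw [hm, hnorm]; nlinarith [sq_nonneg ‖p.1.2‖]) (norm_nonneg _) |>.2
  have hb2 : ∀ p, ‖p.1.2‖ ≤ ‖m p‖ := fun p =>
    abs_le_of_sq_le_sq' (by rw [hm, hnorm]; nlinarith [sq_nonneg ‖p.1.1‖]) (norm_nonneg _) |>.2
  have hbound : ∀ p, ‖p‖ ≤ (1 : NNReal) * ‖m p‖ := fun p => by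
    rw [NNReal.coe_one, one_mul]
    exact max_le (hb1 p) (hb2 p)
  have hanti := ContinuousLinearMap.antilipschitz_of_bound m hbound
  have : CompleteSpace (weakGraph ι X) := (isClosed_weakGraph ι X).completeSpace_coe
  have hcl : IsClosed (LinearMap.range m.toLinearMap : Set H) := by
    rw [LinearMap.coe_range]
    exact hanti.isClosed_range m.uniformContinuous
  have hcompl : CompleteSpace (LinearMap.range m.toLinearMap) := hcl.completeSpace_coe
  have hrange : LinearMap.range m.toLinearMap = ⊤ := by
    rw [← Submodule.orthogonal_eq_bot_iff, Submodule.eq_bot_iff]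
    intro z hz
    rw [Submodule.mem_orthogonal'] at hz
    have hz' : (z, Complex.I • z) ∈ weakGraph ι X := by
      intro d
      have := hz _ ⟨⟨_, hsym.mem_weakGraph d⟩, rfl⟩
      change ⟪z, ι (X d) + Complex.I • ι d⟫_ℂ = 0 at this
      rw [inner_add_right, inner_smul_right] at this
      simp only [inner_smul_left, Complex.conj_I]
      linear_combination this
    have h0 := norm_sq_add_smul hι hF hsym hX hz' (c := -Complex.I) (Or.inr rfl)
    simp only [neg_smul, add_neg_cancel, norm_zero] at h0
    have : ‖z‖ = 0 := by nlinarith [sq_nonneg ‖z‖, sq_nonneg ‖Complex.I • z‖]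
    exact norm_eq_zero.1 this
  let e : weakGraph ι X ≃ₗ[ℂ] H := LinearEquiv.ofBijective m.toLinearMap
    ⟨hanti.injective, LinearMap.range_eq_top.1 hrange⟩
  have he : ∀ p, e p = m p := fun p => rfl
  let R : H →L[ℂ] H := LinearMap.mkContinuous
    (LinearMap.fst ℂ H H ∘ₗ (weakGraph ι X).subtype ∘ₗ e.symm.toLinearMap) 1 (fun x => by
      rw [one_mul]
      have := hb1 (e.symm x)
      rwa [← he, e.apply_symm_apply] at this)
  have hR : ∀ p : weakGraph ι X, R (m p) = p.1.1 := by
    intro p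
    change (e.symm (e p)).1.1 = _
    rw [e.symm_apply_apply]
  refine ⟨R, fun x => ?_, fun p hp => hR ⟨p, hp⟩⟩
  obtain ⟨p, rfl⟩ := e.surjective x
  rw [he, hR, hm, add_sub_cancel_right]
  exact p.2

/-- The resolvent `(X + i)⁻¹` of a regular symmetric operator. -/
def resolvent (hι : DenseRange ι) (hF : IsCutoff F) (hsym : FormalAdjoint X X)
    (hX : IsRegular F X) : H →L[ℂ] H :=
  (exists_resolvent hι hF hsym hX).choose

theorem resolvent_mem (hι : DenseRange ι) (hF : IsCutoff F) (hsym : FormalAdjoint X X)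
    (hX : IsRegular F X) (x : H) :
    (resolvent hι hF hsym hX x, x - Complex.I • resolvent hι hF hsym hX x) ∈ weakGraph ι X :=
  (exists_resolvent hι hF hsym hX).choose_spec.1 x

theorem resolvent_apply (hι : DenseRange ι) (hF : IsCutoff F) (hsym : FormalAdjoint X X)
    (hX : IsRegular F X) {p : H × H} (hp : p ∈ weakGraph ι X) :
    resolvent hι hF hsym hX (p.2 + Complex.I • p.1) = p.1 :=
  (exists_resolvent hι hF hsym hX).choose_spec.2 p hp

/-- An operator commuting with the resolvent preserves the graph. -/
theorem mem_weakGraph_of_commute (hι : DenseRange ι) (hF : IsCutoff F) (hsym : FormalAdjoint X X)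
    (hX : IsRegular F X) {T : H →L[ℂ] H} (hT : Commute (resolvent hι hF hsym hX) T)
    {p : H × H} (hp : p ∈ weakGraph ι X) : (T p.1, T p.2) ∈ weakGraph ι X := by
  have h1 := resolvent_mem hι hF hsym hX (T (p.2 + Complex.I • p.1))
  have h2 : resolvent hι hF hsym hX (T (p.2 + Complex.I • p.1)) = T p.1 := by
    have := DFunLike.congr_fun hT.eq (p.2 + Complex.I • p.1)
    simpa only [mul_apply_eq_comp, resolvent_apply hι hF hsym hX hp] using this
  rw [h2] at h1
  simpa using h1

/-- For d in the core, (Td, TXd) lies in the closed graph. Symmetry of that graph turns ⟨y, TXd⟩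
into ⟨Xy, Td⟩, which is the claim after moving T to the left. -/
theorem star_mem_weakGraph {T : H →L[ℂ] H} (hsym : FormalAdjoint X X)
    (hι : DenseRange ι) (hF : IsCutoff F) (hX : IsRegular F X)
    (hT : ∀ p ∈ weakGraph ι X, (T p.1, T p.2) ∈ weakGraph ι X)
    {p : H × H} (hp : p ∈ weakGraph ι X) : (star T p.1, star T p.2) ∈ weakGraph ι X := by
  intro d
  have h1 := inner_symm_of_mem_weakGraph hι hF hsym hX hp (hT _ (hsym.mem_weakGraph d))
  simpa only [ContinuousLinearMap.star_eq_adjoint, ContinuousLinearMap.adjoint_inner_left] using h1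

/-- If two regular symmetric operators commute on the dense domain, the resolvent of the first
preserves the graph of the second. -/
theorem resolvent_mem_weakGraph (hι : DenseRange ι) (hF : IsCutoff F) (hsym : FormalAdjoint X X)
    (hX : IsRegular F X) {Y : V →ₗ[ℂ] V} (hsymY : FormalAdjoint Y Y) (hY : IsRegular F Y)
    (hXY : ∀ x, X (Y x) = Y (X x)) {p : H × H} (hp : p ∈ weakGraph ι Y) :
    (resolvent hι hF hsym hX p.1, resolvent hι hF hsym hX p.2) ∈ weakGraph ι Y := by
  set R := resolvent hι hF hsym hX with hR
  have hp' := weakGraph_subset_closure hι hF hsymY hY hY hp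
  refine closure_minimal (s := strongGraph ι Y) (t := {p | (R p.1, R p.2) ∈ weakGraph ι Y})
    ?_ ((isClosed_weakGraph ι Y).preimage (by fun_prop)) hp'
  rintro _ ⟨x, rfl⟩
  have hres : ∀ z e, ⟪R (ι z), ι (X e)⟫_ℂ = ⟪z, e⟫_ℂ + Complex.I * ⟪R (ι z), ι e⟫_ℂ := by
    intro z e
    have := resolvent_mem hι hF hsym hX (ι z) e
    simpa only [inner_sub_left, LinearIsometry.inner_map_map, inner_smul_left, Complex.conj_I,
      neg_mul, sub_neg_eq_add] using this
  obtain ⟨K, hK, hK₀⟩ := hX.2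
  -- A single cutoff with ‖K_k‖ < 1 suffices; no limit is taken.
  obtain ⟨k, hk⟩ : ∃ k, ‖K k‖ < 1 := (hK₀.eventually_lt_const zero_lt_one).exists
  obtain ⟨B, hB⟩ := hY.1 k
  obtain ⟨Fe, hFe, _⟩ := exists_extension hι (F k)
  obtain ⟨Be, hBe, _⟩ := exists_extension hι B
  obtain ⟨Ke, hKe, hKe₁⟩ := exists_extension hι (K k)
  -- The functional d ↦ ⟨Rx, Yd⟩ − ⟨RYx, d⟩ must vanish but is not known to be bounded. Substituting
  -- d = F_k e makes it bounded, represented by `v`; since F_k is onto the core, v = 0 is enough.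
  set v : H := Be.adjoint (R (ι x)) - Fe.adjoint (R (ι (Y x))) with hv
  have hve : ∀ e, ⟪v, ι e⟫_ℂ = ⟪R (ι x), ι (Y (F k e))⟫_ℂ - ⟪R (ι (Y x)), ι (F k e)⟫_ℂ := by
    intro e
    rw [hv, inner_sub_left, ContinuousLinearMap.adjoint_inner_left,
      ContinuousLinearMap.adjoint_inner_left, hBe, hFe, hB]
  -- Commuting X past F_k, at the cost of F_k K_k, and then past Y gives (X + i)v = K_k* v in the
  -- weak sense.
  have hmem : (v, Ke.adjoint v - Complex.I • v) ∈ weakGraph ι X := by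
    intro e
    have h1 : F k (X e) = X (F k e) + F k (K k e) := by rw [← hK]; abel
    have h2 := hve (X e)
    have h3 := hve (K k e)
    rw [h1] at h2
    simp only [map_add, inner_add_right, ← hXY, hres] at h2
    rw [hsymY x] at h2
    simp only [inner_sub_left, ContinuousLinearMap.adjoint_inner_left, hKe, inner_smul_left,
      Complex.conj_I]
    linear_combination h2 - h3 - Complex.I * hve e
  -- If v ≠ 0, then ‖v‖ ≤ ‖(X + i)v‖ = ‖K_k* v‖ < ‖v‖.
  have hv0 : v = 0 := by
    have h1 := norm_sq_add_smul hι hF hsym hX hmem (c := Complex.I) (Or.inl rfl)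
    simp only [sub_add_cancel] at h1
    have h2 : ‖Ke.adjoint v‖ ≤ ‖K k‖ * ‖v‖ := by
      refine Ke.adjoint.le_of_opNorm_le ?_ v
      rwa [LinearIsometryEquiv.norm_map]
    by_contra hne
    have h3 : 0 < ‖v‖ := norm_pos_iff.2 hne
    have h4 : ‖Ke.adjoint v‖ < ‖v‖ := by nlinarith
    nlinarith [sq_nonneg ‖Ke.adjoint v - Complex.I • v‖, norm_nonneg (Ke.adjoint v)]
  intro d
  obtain ⟨e, rfl⟩ := hF.surjective k d
  have := hve e
  rw [hv0, inner_zero_left] at this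
  exact (sub_eq_zero.1 this.symm)

/-- Since R_X preserves the graph of Y, applying it to the pair (R_Y z, z − iR_Y z) gives (Y + i)R_X
R_Y z = R_X z; then invert Y + i. -/
theorem resolvent_commute (hι : DenseRange ι) (hF : IsCutoff F) (hsym : FormalAdjoint X X)
    (hX : IsRegular F X) {Y : V →ₗ[ℂ] V} (hsymY : FormalAdjoint Y Y) (hY : IsRegular F Y)
    (hXY : ∀ x, X (Y x) = Y (X x)) :
    Commute (resolvent hι hF hsym hX) (resolvent hι hF hsymY hY) := by
  ext z
  have h1 := resolvent_mem_weakGraph hι hF hsym hX hsymY hY hXY (resolvent_mem hι hF hsymY hY z)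
  have h2 := resolvent_apply hι hF hsymY hY h1
  simp only [map_sub, map_smul, sub_add_cancel] at h2
  simp only [mul_apply_eq_comp, h2]

end Symmetric

end WeakGraph

/-! ### Contractions of symmetric tensors and their adjoints -/

namespace BoseFock

variable {h : Type u} [NormedAddCommGroup h] [InnerProductSpace ℂ h]

theorem inner_elemTensor (n : ℕ) (v w : Fin n → h) :
    ⟪elemTensor n v, elemTensor n w⟫_ℂ = ∏ i, ⟪v i, w i⟫_ℂ := by
  induction n with
  | zero =>
    let e : EuclideanSpace ℂ PUnit.{u + 1} := EuclideanSpace.single PUnit.unit 1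
    change ⟪e, e⟫_ℂ = _
    simp [e]
  | succ n ih =>
    rw [Fin.prod_univ_succ, ← ih]
    exact TensorProduct.inner_tmul (𝕜 := ℂ) (E := h) (F := AlgPow h n) _ _ _ _

theorem inner_symTensor_elemTensor (n : ℕ) (v w : Fin n → h) :
    ⟪symTensor n w, ((elemTensor n v : AlgPow h n) : HilbertPow h n)⟫_ℂ =
      ∑ τ : Equiv.Perm (Fin n), ∏ i, ⟪w (τ i), v i⟫_ℂ := by
  rw [symTensor, sum_inner]
  refine Finset.sum_congr rfl fun τ _ => ?_
  rw [UniformSpace.Completion.inner_coe, inner_elemTensor]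

theorem inner_symTensor_elemTensor_perm (n : ℕ) (v w : Fin n → h) (σ : Equiv.Perm (Fin n)) :
    ⟪symTensor n w, ((elemTensor n (fun i => v (σ i)) : AlgPow h n) : HilbertPow h n)⟫_ℂ =
      ⟪symTensor n w, ((elemTensor n v : AlgPow h n) : HilbertPow h n)⟫_ℂ := by
  rw [inner_symTensor_elemTensor, inner_symTensor_elemTensor]
  rw [← Equiv.sum_comp (Equiv.mulRight σ)]
  refine Finset.sum_congr rfl fun τ _ => ?_
  exact Equiv.prod_comp σ fun i => ⟪w (τ i), v i⟫_ℂ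

theorem symTensor_perm (n : ℕ) (v : Fin n → h) (σ : Equiv.Perm (Fin n)) :
    symTensor n (fun i => v (σ i)) = symTensor n v := by
  unfold symTensor
  rw [← Equiv.sum_comp (Equiv.mulLeft σ) fun τ : Equiv.Perm (Fin n) =>
    ((elemTensor n (fun i => v (τ i)) : AlgPow h n) : HilbertPow h n)]
  rfl

/-- A symmetrised elementary tensor as an element of the symmetric tensor power. -/
def symVec (n : ℕ) (v : Fin n → h) : symPow h n :=
  ⟨symTensor n v, Submodule.le_topologicalClosure _ (Submodule.subset_span ⟨v, rfl⟩)⟩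

theorem symVec_perm (n : ℕ) (v : Fin n → h) (σ : Equiv.Perm (Fin n)) :
    symVec n (fun i => v (σ i)) = symVec n v := Subtype.ext (symTensor_perm n v σ)

theorem symPow_induction {n : ℕ} {E : Submodule ℂ (symPow h n)} (hE : IsClosed (E : Set (symPow h n)))
    (hv : ∀ v, symVec n v ∈ E) (x : symPow h n) : x ∈ E := by
  have hcl : IsClosed ((E.map (symPow h n).subtype : Submodule ℂ (HilbertPow h n)) :
      Set (HilbertPow h n)) := by
    rw [Submodule.map_coe]
    exact (Submodule.isClosed_topologicalClosure _).isClosedEmbedding_subtypeVal.isClosedMap _ hE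
  have hle : symPow h n ≤ E.map (symPow h n).subtype := by
    refine Submodule.topologicalClosure_minimal _ (Submodule.span_le.2 ?_) hcl
    rintro _ ⟨v, rfl⟩
    exact ⟨symVec n v, hv v, rfl⟩
  obtain ⟨y, hy, hyx⟩ := hle x.2
  rwa [← Subtype.ext hyx]

theorem symPow_clm_ext {n : ℕ} {G : Type*} [NormedAddCommGroup G] [NormedSpace ℂ G]
    {f g : symPow h n →L[ℂ] G} (hfg : ∀ v, f (symVec n v) = g (symVec n v)) : f = g := by
  ext x
  exact symPow_induction (E := LinearMap.eqLocus f.toLinearMap g.toLinearMap)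
    (isClosed_eq f.continuous g.continuous) hfg x

/-- Holds for symmetrised tensors by reindexing the sum over permutations, and extends to all of
`symPow h n` by continuity. -/
theorem inner_elemTensor_perm {n : ℕ} (x : symPow h n) (v : Fin n → h) (σ : Equiv.Perm (Fin n)) :
    ⟪(x : HilbertPow h n), ((elemTensor n (fun i => v (σ i)) : AlgPow h n) : HilbertPow h n)⟫_ℂ =
      ⟪(x : HilbertPow h n), ((elemTensor n v : AlgPow h n) : HilbertPow h n)⟫_ℂ := by
  rw [← sub_eq_zero, ← inner_sub_right, inner_eq_zero_symm]
  set d := ((elemTensor n (fun i => v (σ i)) : AlgPow h n) : HilbertPow h n) -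
    ((elemTensor n v : AlgPow h n) : HilbertPow h n) with hd
  refine DFunLike.congr_fun (symPow_clm_ext (f := innerSL ℂ d ∘L (symPow h n).subtypeL) (g := 0)
    fun w => ?_) x
  change ⟪d, symTensor n w⟫_ℂ = 0
  rw [inner_eq_zero_symm, hd, inner_sub_right, inner_symTensor_elemTensor_perm, sub_self]

theorem inner_symTensor {n : ℕ} (x : symPow h n) (v : Fin n → h) :
    ⟪(x : HilbertPow h n), symTensor n v⟫_ℂ =
      (n.factorial : ℂ) * ⟪(x : HilbertPow h n), ((elemTensor n v : AlgPow h n) : HilbertPow h n)⟫_ℂ := by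
  rw [symTensor, inner_sum]
  simp only [inner_elemTensor_perm, Finset.sum_const, Finset.card_univ, Fintype.card_perm,
    Fintype.card_fin, nsmul_eq_mul]

/-- Before symmetrisation, the adjoint of contraction with φ is tensoring with φ on the left. -/
theorem inner_contract_elemTensor (φ : h) (n : ℕ) (x : HilbertPow h (n + 1)) (v : Fin n → h) :
    ⟪contract φ n x, ((elemTensor n v : AlgPow h n) : HilbertPow h n)⟫_ℂ =
      ⟪x, ((elemTensor (n + 1) (Fin.cons φ v) : AlgPow h (n + 1)) : HilbertPow h (n + 1))⟫_ℂ := by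
  induction x using UniformSpace.Completion.induction_on with
  | hp => exact isClosed_eq (by fun_prop) (by fun_prop)
  | ih a =>
    rw [contract_coe, UniformSpace.Completion.inner_coe, UniformSpace.Completion.inner_coe]
    change h ⊗[ℂ] AlgPow h n at a
    change ⟪TensorProduct.lid ℂ (AlgPow h n) (TensorProduct.mapL (innerSL ℂ φ)
      (ContinuousLinearMap.id ℂ (AlgPow h n)) a), _⟫_ℂ = ⟪a, φ ⊗ₜ[ℂ] elemTensor n v⟫_ℂ
    induction a using TensorProduct.induction_on with
    | zero => simp
    | tmul y t =>
      rw [TensorProduct.mapL_tmul, TensorProduct.inner_tmul]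
      simp [mul_comm]
    | add a b ha hb => rw [map_add, map_add, inner_add_left, inner_add_left, ha, hb]

theorem norm_contract_le (φ : h) (n : ℕ) (x : HilbertPow h (n + 1)) :
    ‖contract φ n x‖ ≤ ‖φ‖ * ‖x‖ := by
  induction x using UniformSpace.Completion.induction_on with
  | hp => exact isClosed_le (by fun_prop) (by fun_prop)
  | ih a =>
    rw [contract_coe, UniformSpace.Completion.norm_coe, UniformSpace.Completion.norm_coe]
    change ‖TensorProduct.lid ℂ (AlgPow h n) (TensorProduct.mapL (innerSL ℂ φ)
      (ContinuousLinearMap.id ℂ (AlgPow h n)) a)‖ ≤ _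
    rw [TensorProduct.norm_lid]
    refine ContinuousLinearMap.le_of_opNorm_le _ ((TensorProduct.norm_mapL_le _ _).trans ?_) a
    rw [innerSL_apply_norm]
    exact mul_le_of_le_one_right (norm_nonneg _) ContinuousLinearMap.norm_id_le

theorem norm_symContract_le (φ : h) (n : ℕ) (x : symPow h (n + 1)) :
    ‖symContract φ n x‖ ≤ ‖φ‖ * ‖x‖ := norm_contract_le φ n x

theorem symContract_symVec (φ : h) (n : ℕ) (v : Fin (n + 1) → h) :
    symContract φ n (symVec (n + 1) v) =
      ∑ p : Fin (n + 1), ⟪φ, v p⟫_ℂ • symVec n (fun i => v (Equiv.swap 0 p i.succ)) := by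
  refine Subtype.ext ?_
  rw [AddSubmonoidClass.coe_finsetSum]
  exact contract_symTensor φ n v

/-- The adjoint of the contraction on the symmetric tensor powers. -/
def symInsert (φ : h) (n : ℕ) : symPow h n →L[ℂ] symPow h (n + 1) := (symContract φ n).adjoint

/-- The factor n + 1 is the ratio (n+1)!/n! of the two unnormalised symmetrisations, each of which
pairs with a symmetric vector as a factorial times one elementary tensor. -/
theorem symInsert_symVec (φ : h) (n : ℕ) (v : Fin n → h) :
    ((n : ℂ) + 1) • symInsert φ n (symVec n v) = symVec (n + 1) (Fin.cons φ v) := by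
  refine ext_inner_left ℂ fun x => ?_
  have h1 := inner_symTensor (symContract φ n x) v
  have h2 := inner_symTensor x (Fin.cons φ v : Fin (n + 1) → h)
  refine (inner_smul_right (𝕜 := ℂ) (E := symPow h (n + 1)) _ _ _).trans ?_
  rw [symInsert, ContinuousLinearMap.adjoint_inner_right]
  change _ * ⟪(symContract φ n x : HilbertPow h n), symTensor n v⟫_ℂ =
    ⟪(x : HilbertPow h (n + 1)), symTensor (n + 1) (Fin.cons φ v)⟫_ℂ
  rw [h1, h2, Nat.factorial_succ, Nat.cast_mul, Nat.cast_succ, mul_assoc,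
    ← inner_contract_elemTensor]
  rfl

theorem symInsert_symVec' (φ : h) (n : ℕ) (v : Fin n → h) :
    symInsert φ n (symVec n v) = ((n : ℂ) + 1)⁻¹ • symVec (n + 1) (Fin.cons φ v) := by
  rw [← symInsert_symVec, inv_smul_smul₀ (Nat.cast_add_one_ne_zero n)]

/-- On generators the two orders differ by the transposition of the first two slots. -/
theorem symInsert_comm (φ ψ : h) (n : ℕ) (x : symPow h n) :
    symInsert φ (n + 1) (symInsert ψ n x) = symInsert ψ (n + 1) (symInsert φ n x) := by
  refine DFunLike.congr_fun (symPow_clm_ext (f := symInsert φ (n + 1) ∘L symInsert ψ n)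
    (g := symInsert ψ (n + 1) ∘L symInsert φ n) fun v => ?_) x
  simp only [ContinuousLinearMap.comp_apply, symInsert_symVec', map_smul]
  congr 2
  rw [← symVec_perm _ _ (Equiv.swap 0 1)]
  congr 1
  funext i
  refine Fin.cases ?_ (fun j => ?_) i
  · simp
  · refine Fin.cases ?_ (fun k => ?_) j
    · simp
    · rw [Equiv.swap_apply_of_ne_of_ne (Fin.succ_ne_zero _) (by simp [Fin.ext_iff])]
      simp

theorem symContract_symInsert_zero (φ ψ : h) (x : symPow h 0) :
    symContract φ 0 (symInsert ψ 0 x) = ⟪φ, ψ⟫_ℂ • x := by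
  refine DFunLike.congr_fun (symPow_clm_ext (f := symContract φ 0 ∘L symInsert ψ 0)
    (g := ⟪φ, ψ⟫_ℂ • ContinuousLinearMap.id ℂ _) fun v => ?_) x
  simp [symInsert_symVec', symContract_symVec]

/-- The commutation relation with the square roots stripped off: n + 2 and n + 1 are the products of
the two ladder factors. On a generator, contracting the inserted slot gives ⟨φ,ψ⟩, and contracting
any other slot leaves ψ inserted into a contraction of v. -/
theorem symContract_symInsert_succ (φ ψ : h) (n : ℕ) (x : symPow h (n + 1)) :
    ((n : ℂ) + 2) • symContract φ (n + 1) (symInsert ψ (n + 1) x) =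
      ⟪φ, ψ⟫_ℂ • x + ((n : ℂ) + 1) • symInsert ψ n (symContract φ n x) := by
  refine DFunLike.congr_fun (symPow_clm_ext
    (f := ((n : ℂ) + 2) • (symContract φ (n + 1) ∘L symInsert ψ (n + 1)))
    (g := ⟪φ, ψ⟫_ℂ • ContinuousLinearMap.id ℂ _ +
      ((n : ℂ) + 1) • (symInsert ψ n ∘L symContract φ n)) fun v => ?_) x
  have h1 : ((n : ℂ) + 2) • symInsert ψ (n + 1) (symVec (n + 1) v) =
      symVec (n + 2) (Fin.cons ψ v) := by
    rw [← symInsert_symVec]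
    push_cast
    ring_nf
  simp only [smul_apply, add_apply, ContinuousLinearMap.comp_apply, ContinuousLinearMap.id_apply]
  rw [← map_smul, h1, symContract_symVec, symContract_symVec, Fin.sum_univ_succ, map_sum,
    Finset.smul_sum]
  congr 1
  refine Finset.sum_congr rfl fun q _ => ?_
  rw [map_smul, smul_comm, symInsert_symVec, Fin.cons_succ]
  congr 1
  -- Contracting slot q + 1 leaves ψ in slot q, whereas insertion puts it in slot 0; this
  -- transposition reconciles the two.
  rw [← symVec_perm (n + 1) (Fin.cons ψ _) (Equiv.swap 0 q)]
  congr 1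
  funext j
  rcases eq_or_ne j q with rfl | hjq
  · simp
  · rw [Equiv.swap_apply_of_ne_of_ne (Fin.succ_ne_zero _) (by simpa using hjq), Fin.cons_succ]
    refine Fin.cases (fun hjq => ?_) (fun k hjq => ?_) j hjq
    · rw [Equiv.swap_apply_left]
      obtain ⟨k, rfl⟩ := Fin.exists_succ_eq.2 hjq.symm
      simp
    · rw [Equiv.swap_apply_of_ne_of_ne (Fin.succ_ne_zero _) hjq, Fin.cons_succ,
        Equiv.swap_apply_of_ne_of_ne (Fin.succ_ne_zero _) hjq]

end BoseFock

/-! ### Ladder operators on finitely supported vectors of a Hilbert sum -/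

namespace HilbertSum

open Filter Topology WeakGraph

variable {G : ℕ → Type*} [∀ n, NormedAddCommGroup (G n)] [∀ n, InnerProductSpace ℂ (G n)]

variable (G) in
/-- The finitely supported vectors of a Hilbert sum. -/
def finSupp : Submodule ℂ (lp G 2) where
  carrier := {Ψ | (Function.support fun n : ℕ => ‖Ψ n‖).Finite}
  zero_mem' := by simp [Function.support]
  add_mem' := by
    intro Ψ Φ hΨ hΦ
    refine (Set.Finite.union hΨ hΦ).subset fun n hn => ?_
    by_contra hcon
    simp only [Set.mem_union, Function.mem_support, not_or, not_not, norm_eq_zero] at hcon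
    exact hn (by simp [hcon.1, hcon.2])
  smul_mem' := by
    intro c Ψ hΨ
    refine Set.Finite.subset hΨ fun n hn hcon => hn ?_
    simp only [norm_eq_zero] at hcon
    simp [hcon]

/-- The components of a finitely supported vector. -/
def comp (Ψ : finSupp G) (n : ℕ) : G n := (Ψ : lp G 2) n

theorem finite_support (Ψ : finSupp G) : {n | comp Ψ n ≠ 0}.Finite := by
  refine Set.Finite.subset Ψ.2 fun n hn => ?_
  rw [Function.mem_support]
  exact norm_ne_zero_iff.2 hn

theorem finSupp_ext {Ψ Φ : finSupp G} (hΨΦ : ∀ n, comp Ψ n = comp Φ n) : Ψ = Φ :=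
  Subtype.ext (lp.ext (funext hΨΦ))

theorem comp_add (Ψ Φ : finSupp G) (n : ℕ) : comp (Ψ + Φ) n = comp Ψ n + comp Φ n := rfl

theorem comp_sub (Ψ Φ : finSupp G) (n : ℕ) : comp (Ψ - Φ) n = comp Ψ n - comp Φ n := rfl

theorem comp_smul (c : ℂ) (Ψ : finSupp G) (n : ℕ) : comp (c • Ψ) n = c • comp Ψ n := rfl

/-- The finitely supported vector with given components. -/
def mkFinite (f : ∀ n, G n) (hf : {n | f n ≠ 0}.Finite) : finSupp G :=
  ⟨⟨f, (memℓp_zero hf).of_exponent_ge zero_le⟩, hf.subset fun _ hn =>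
    norm_ne_zero_iff.1 (Function.mem_support.1 hn)⟩

theorem comp_mkFinite (f : ∀ n, G n) (hf : {n | f n ≠ 0}.Finite) (n : ℕ) :
    comp (mkFinite f hf) n = f n := rfl

/-- Multiplication by a function of the degree. -/
def diag (w : ℕ → ℝ) : finSupp G →ₗ[ℂ] finSupp G where
  toFun Ψ := mkFinite (fun n => (w n : ℂ) • comp Ψ n)
    ((finite_support Ψ).subset fun n hn h0 => hn (by rw [h0, smul_zero]))
  map_add' Ψ Φ := finSupp_ext fun n => by
    simp only [comp_mkFinite, comp_add, smul_add]
  map_smul' c Ψ := finSupp_ext fun n => by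
    simp only [comp_mkFinite, comp_smul, RingHom.id_apply, smul_comm c]

theorem comp_diag (w : ℕ → ℝ) (Ψ : finSupp G) (n : ℕ) :
    comp (diag w Ψ) n = (w n : ℂ) • comp Ψ n := rfl

/-- The operator lowering the degree by one, with given components. -/
def lower (c : ∀ n, G (n + 1) →L[ℂ] G n) : finSupp G →ₗ[ℂ] finSupp G where
  toFun Ψ := mkFinite (fun n => c n (comp Ψ (n + 1)))
    (((finite_support Ψ).preimage (add_left_injective 1).injOn).subset
      fun n hn h0 => hn (by rw [h0, map_zero]))
  map_add' Ψ Φ := finSupp_ext fun n => by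
    simp only [comp_mkFinite, comp_add, map_add]
  map_smul' c Ψ := finSupp_ext fun n => by
    simp only [comp_mkFinite, comp_smul, RingHom.id_apply, map_smul]

theorem comp_lower (c : ∀ n, G (n + 1) →L[ℂ] G n) (Ψ : finSupp G) (n : ℕ) :
    comp (lower c Ψ) n = c n (comp Ψ (n + 1)) := rfl

/-- The components of the image of a sequence under an operator raising the degree. -/
def raiseSeq (d : ∀ n, G n →L[ℂ] G (n + 1)) (Ψ : ∀ n, G n) : ∀ n, G n
  | 0 => 0
  | n + 1 => d n (Ψ n)

/-- The operator raising the degree by one, with given components. -/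
def raise (d : ∀ n, G n →L[ℂ] G (n + 1)) : finSupp G →ₗ[ℂ] finSupp G where
  toFun Ψ := mkFinite (raiseSeq d (comp Ψ))
    (((finite_support Ψ).image (· + 1)).subset fun n hn => by
      cases n with
      | zero => exact (hn rfl).elim
      | succ n => exact ⟨n, fun h0 => hn (by rw [raiseSeq, h0, map_zero]), rfl⟩)
  map_add' Ψ Φ := finSupp_ext fun n => by
    cases n with
    | zero => simp only [comp_mkFinite, comp_add, raiseSeq, add_zero]
    | succ n => simp only [comp_mkFinite, comp_add, raiseSeq, map_add]
  map_smul' c Ψ := finSupp_ext fun n => by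
    cases n with
    | zero => simp only [comp_mkFinite, comp_smul, raiseSeq, smul_zero]
    | succ n => simp only [comp_mkFinite, comp_smul, RingHom.id_apply, raiseSeq, map_smul]

theorem comp_raise_zero (d : ∀ n, G n →L[ℂ] G (n + 1)) (Ψ : finSupp G) :
    comp (raise d Ψ) 0 = 0 := rfl

theorem comp_raise_succ (d : ∀ n, G n →L[ℂ] G (n + 1)) (Ψ : finSupp G) (n : ℕ) :
    comp (raise d Ψ) (n + 1) = d n (comp Ψ n) := rfl

theorem sum_norm_sq_le (Ψ : finSupp G) (s : Finset ℕ) :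
    ∑ n ∈ s, ‖comp Ψ n‖ ^ (2 : ℝ≥0∞).toReal ≤ ‖Ψ‖ ^ (2 : ℝ≥0∞).toReal :=
  lp.sum_rpow_le_norm_rpow (by norm_num) (Ψ : lp G 2) s

theorem norm_le_of_forall_sum_le {Ψ : finSupp G} {C : ℝ} (hC : 0 ≤ C)
    (hΨ : ∀ s : Finset ℕ, ∑ n ∈ s, ‖comp Ψ n‖ ^ (2 : ℝ≥0∞).toReal ≤ C ^ (2 : ℝ≥0∞).toReal) :
    ‖Ψ‖ ≤ C :=
  lp.norm_le_of_forall_sum_le (by norm_num) hC hΨ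

theorem norm_le_of_comp_le {Φ Ψ : finSupp G} {M : ℝ} (hM : 0 ≤ M) {e : ℕ → ℕ} (he : e.Injective)
    (hle : ∀ n, ‖comp Φ n‖ ≤ M * ‖comp Ψ (e n)‖) : ‖Φ‖ ≤ M * ‖Ψ‖ := by
  have h2 : (0 : ℝ) < (2 : ℝ≥0∞).toReal := by norm_num
  refine norm_le_of_forall_sum_le (mul_nonneg hM (norm_nonneg _)) fun s => ?_
  have h3 := sum_norm_sq_le Ψ (s.map ⟨e, he⟩)
  rw [Finset.sum_map] at h3
  rw [Real.mul_rpow hM (norm_nonneg _)]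
  refine le_trans ?_ (mul_le_mul_of_nonneg_left h3 (Real.rpow_nonneg hM _))
  rw [Finset.mul_sum]
  refine Finset.sum_le_sum fun n _ => ?_
  rw [← Real.mul_rpow hM (norm_nonneg _)]
  exact Real.rpow_le_rpow (norm_nonneg _) (hle n) h2.le

theorem inner_shift {Φ X Ψ Y : lp G 2} (h0 : Φ 0 = 0)
    (hs : ∀ n, ⟪Φ (n + 1), X (n + 1)⟫_ℂ = ⟪Ψ n, Y n⟫_ℂ) : ⟪Φ, X⟫_ℂ = ⟪Ψ, Y⟫_ℂ := by
  have h1 : Summable fun n => ⟪Φ n, X n⟫_ℂ := lp.summable_inner Φ X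
  have h2 : ⟪Φ 0, X 0⟫_ℂ = 0 := by rw [h0, inner_zero_left]
  rw [lp.inner_eq_tsum, lp.inner_eq_tsum, h1.tsum_eq_zero_add, h2, zero_add]
  exact tsum_congr hs

theorem raise_lower_formalAdjoint {c : ∀ n, G (n + 1) →L[ℂ] G n} {d : ∀ n, G n →L[ℂ] G (n + 1)}
    (hcd : ∀ n x y, ⟪d n x, y⟫_ℂ = ⟪x, c n y⟫_ℂ) :
    FormalAdjoint (V := finSupp G) (raise d) (lower c) :=
  fun Ψ Φ => inner_shift (Φ := (raise d Ψ).1) (X := Φ.1) (Ψ := Ψ.1) (Y := (lower c Φ).1) rfl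
    fun n => hcd n _ _

theorem norm_lower_le {c : ∀ n, G (n + 1) →L[ℂ] G n} {M : ℝ} (hM : 0 ≤ M)
    (hc : ∀ n x, ‖c n x‖ ≤ M * ‖x‖) (Ψ : finSupp G) : ‖lower c Ψ‖ ≤ M * ‖Ψ‖ :=
  norm_le_of_comp_le hM (add_left_injective 1) fun n => hc n _

/-- `norm_le_of_comp_le` does not fit, as degree 0 of the image has no source. That component is
zero, so any finite sum of components is bounded by a shifted sum over a long enough initial range.
-/
theorem norm_raise_le {d : ∀ n, G n →L[ℂ] G (n + 1)} {M : ℝ} (hM : 0 ≤ M)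
    (hd : ∀ n x, ‖d n x‖ ≤ M * ‖x‖) (Ψ : finSupp G) : ‖raise d Ψ‖ ≤ M * ‖Ψ‖ := by
  have h2 : (0 : ℝ) < (2 : ℝ≥0∞).toReal := by norm_num
  refine norm_le_of_forall_sum_le (mul_nonneg hM (norm_nonneg _)) fun s => ?_
  have h3 : ∑ n ∈ s, ‖comp (raise d Ψ) n‖ ^ (2 : ℝ≥0∞).toReal ≤
      ∑ n ∈ Finset.range (s.sup id + 1), ‖comp (raise d Ψ) (n + 1)‖ ^ (2 : ℝ≥0∞).toReal := by
    have h4 := Finset.sum_range_succ' (fun n => ‖comp (raise d Ψ) n‖ ^ (2 : ℝ≥0∞).toReal)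
      (s.sup id + 1)
    rw [comp_raise_zero, norm_zero, Real.zero_rpow h2.ne', add_zero] at h4
    rw [← h4]
    refine Finset.sum_le_sum_of_subset_of_nonneg (fun n hn => ?_)
      fun n _ _ => Real.rpow_nonneg (norm_nonneg _) _
    have : n ≤ s.sup id := Finset.le_sup (f := id) hn
    exact Finset.mem_range.2 (by omega)
  refine h3.trans ?_
  rw [Real.mul_rpow hM (norm_nonneg _)]
  refine le_trans ?_ (mul_le_mul_of_nonneg_left (sum_norm_sq_le Ψ (Finset.range (s.sup id + 1)))
    (Real.rpow_nonneg hM _))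
  rw [Finset.mul_sum]
  refine Finset.sum_le_sum fun n _ => ?_
  rw [← Real.mul_rpow hM (norm_nonneg _), comp_raise_succ]
  exact Real.rpow_le_rpow (norm_nonneg _) (hd n _) h2.le

theorem norm_diag_le {w : ℕ → ℝ} {M : ℝ} (hM : 0 ≤ M) (Ψ : finSupp G)
    (hw : ∀ n, comp Ψ n ≠ 0 → |w n| ≤ M) : ‖diag w Ψ‖ ≤ M * ‖Ψ‖ := by
  refine norm_le_of_comp_le hM Function.injective_id fun n => ?_
  rw [comp_diag, norm_smul, Complex.norm_real, Real.norm_eq_abs]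
  by_cases h0 : comp Ψ n = 0
  · rw [id, h0, norm_zero, mul_zero, mul_zero]
  · exact mul_le_mul_of_nonneg_right (hw n h0) (norm_nonneg _)

/-! ### Degree cutoffs and the regularity of ladder operators. -/

/-- The weights `k / (n + k)` (shifted to avoid `k = 0`) of the cutoffs. -/
def cutoffWeight (k n : ℕ) : ℝ := ((k : ℝ) + 1) / ((n : ℝ) + k + 1)

theorem cutoffWeight_pos (k n : ℕ) : 0 < cutoffWeight k n := by
  unfold cutoffWeight
  positivity

theorem abs_cutoffWeight_le (k n : ℕ) : |cutoffWeight k n| ≤ 1 := by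
  rw [abs_of_pos (cutoffWeight_pos k n), cutoffWeight, div_le_one (by positivity)]
  linarith [(Nat.cast_nonneg n : (0 : ℝ) ≤ n)]

variable (G) in
/-- The cutoffs in the degree. -/
def cutoff (k : ℕ) : finSupp G →L[ℂ] finSupp G :=
  (diag (cutoffWeight k)).mkContinuous 1 fun Ψ =>
    norm_diag_le zero_le_one Ψ fun n _ => abs_cutoffWeight_le k n

theorem comp_cutoff (k : ℕ) (Ψ : finSupp G) (n : ℕ) :
    comp (cutoff G k Ψ) n = (cutoffWeight k n : ℂ) • comp Ψ n := rfl

theorem isCutoff_cutoff : IsCutoff (V := finSupp G) (cutoff G) where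
  norm_le k := LinearMap.mkContinuous_norm_le _ zero_le_one _
  symmetric k Ψ Φ := by
    change ⟪(cutoff G k Ψ : lp G 2), (Φ : lp G 2)⟫_ℂ = ⟪(Ψ : lp G 2), (cutoff G k Φ : lp G 2)⟫_ℂ
    rw [lp.inner_eq_tsum, lp.inner_eq_tsum]
    refine tsum_congr fun n => ?_
    change ⟪(cutoffWeight k n : ℂ) • comp Ψ n, comp Φ n⟫_ℂ =
      ⟪comp Ψ n, (cutoffWeight k n : ℂ) • comp Φ n⟫_ℂ
    rw [inner_smul_left, inner_smul_right, Complex.conj_ofReal]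
  tendsto Ψ := by
    obtain ⟨N, hN⟩ := (finite_support Ψ).bddAbove
    rw [tendsto_iff_norm_sub_tendsto_zero]
    have hlim : Tendsto (fun k : ℕ => (N : ℝ) * (1 / ((k : ℝ) + 1)) * ‖Ψ‖) atTop (𝓝 0) := by
      simpa using (tendsto_one_div_add_atTop_nhds_zero_nat.const_mul (N : ℝ)).mul_const ‖Ψ‖
    refine squeeze_zero (fun _ => norm_nonneg _) (fun k => ?_) hlim
    have h1 : cutoff G k Ψ - Ψ = diag (fun n => cutoffWeight k n - 1) Ψ := by
      refine finSupp_ext fun n => ?_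
      rw [comp_sub, comp_cutoff, comp_diag, Complex.ofReal_sub, sub_smul, Complex.ofReal_one,
        one_smul]
    rw [h1]
    refine norm_diag_le (by positivity) Ψ fun n hn => ?_
    have hn' : (n : ℝ) ≤ N := by exact_mod_cast hN hn
    have h2 : cutoffWeight k n - 1 = -((n : ℝ) / ((n : ℝ) + k + 1)) := by
      unfold cutoffWeight
      field_simp
      ring
    rw [h2, abs_neg, abs_of_nonneg (by positivity), mul_one_div]
    refine div_le_div₀ (by positivity) hn' (by positivity) ?_
    linarith [(Nat.cast_nonneg n : (0 : ℝ) ≤ n)]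
  surjective k Ψ := by
    refine ⟨diag (fun n => (cutoffWeight k n)⁻¹) Ψ, finSupp_ext fun n => ?_⟩
    rw [comp_cutoff, comp_diag, smul_smul, ← Complex.ofReal_mul,
      mul_inv_cancel₀ (cutoffWeight_pos k n).ne', Complex.ofReal_one, one_smul]

/-- Squared and cleared of denominators, this is (n+1)(k+1) ≤ (n+k+1)². It trades the √n growth of
ladder operators for decay in k, uniformly in n. -/
theorem sqrt_div_le (k n : ℕ) :
    √((n : ℝ) + 1) / ((n : ℝ) + k + 1) ≤ 1 / √((k : ℝ) + 1) := by
  rw [div_le_div_iff₀ (by positivity) (by positivity), ← Real.sqrt_mul (by positivity), one_mul]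
  refine Real.sqrt_le_iff.2 ⟨by positivity, ?_⟩
  have hn : (0 : ℝ) ≤ n := Nat.cast_nonneg n
  have hk : (0 : ℝ) ≤ k := Nat.cast_nonneg k
  nlinarith [mul_nonneg hn hk]

theorem sqrt_div_succ_le (k n : ℕ) :
    √((n : ℝ) + 1) / ((n : ℝ) + k + 2) ≤ 1 / √((k : ℝ) + 1) := by
  refine le_trans ?_ (sqrt_div_le k n)
  exact div_le_div_of_nonneg_left (Real.sqrt_nonneg _) (by positivity) (by linarith)

theorem tendsto_const_div_sqrt (C : ℝ) :
    Tendsto (fun k : ℕ => 1 / √((k : ℝ) + 1) * C) atTop (𝓝 0) := by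
  have h1 : Tendsto (fun k : ℕ => √((k : ℝ) + 1)) atTop atTop :=
    Real.tendsto_sqrt_atTop.comp (tendsto_natCast_atTop_atTop.atTop_add tendsto_const_nhds)
  simpa using (h1.inv_tendsto_atTop).mul_const C

theorem norm_ofReal_smul_le {E : Type*} [NormedAddCommGroup E] [InnerProductSpace ℂ E] {w M C r : ℝ}
    {x : E} {N : ℝ} (hx : ‖x‖ ≤ r * M * N) (hr : |w| * r ≤ C) (hM : 0 ≤ M)
    (hN : 0 ≤ N) : ‖(w : ℂ) • x‖ ≤ C * M * N := by
  rw [norm_smul, Complex.norm_real, Real.norm_eq_abs]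
  calc |w| * ‖x‖ ≤ |w| * (r * M * N) := mul_le_mul_of_nonneg_left hx (abs_nonneg w)
    _ = |w| * r * (M * N) := by ring
    _ ≤ C * (M * N) := mul_le_mul_of_nonneg_right hr (mul_nonneg hM hN)
    _ = C * M * N := by ring

/-- The weights satisfy w(n) − w(n+1) = w(n)/(n+k+2), so K_k has components c_n/(n+k+2). As w(n+1) =
(k+1)/(n+k+2), the same operator gives X F_k = (k+1)K_k. -/
theorem isRegular_lower {c : ∀ n, G (n + 1) →L[ℂ] G n} {M : ℝ} (hM : 0 ≤ M)
    (hc : ∀ n x, ‖c n x‖ ≤ √((n : ℝ) + 1) * M * ‖x‖) :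
    IsRegular (V := finSupp G) (cutoff G) (lower c) := by
  let κ : ∀ k n : ℕ, G (n + 1) →L[ℂ] G n := fun k n => ((((n : ℝ) + k + 2)⁻¹ : ℝ) : ℂ) • c n
  have hκ : ∀ k Ψ, ‖lower (κ k) Ψ‖ ≤ 1 / √((k : ℝ) + 1) * M * ‖Ψ‖ := fun k =>
    norm_lower_le (by positivity) fun n x => norm_ofReal_smul_le (hc n x)
      (by rw [abs_of_pos (by positivity), inv_mul_eq_div]; exact sqrt_div_succ_le k n) hM (norm_nonneg x)
  let K : ℕ → finSupp G →L[ℂ] finSupp G := fun k => (lower (κ k)).mkContinuous _ (hκ k)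
  have hK : ∀ k Ψ n, comp (K k Ψ) n = ((((n : ℝ) + k + 2)⁻¹ : ℝ) : ℂ) • c n (comp Ψ (n + 1)) :=
    fun k Ψ n => rfl
  refine ⟨fun k => ⟨((k : ℂ) + 1) • K k, fun Ψ => ?_⟩, K, fun k Ψ => ?_, ?_⟩
  · refine finSupp_ext fun n => ?_
    rw [smul_apply, comp_smul, hK, comp_lower, comp_cutoff, map_smul, smul_smul]
    congr 1
    unfold cutoffWeight
    push_cast
    ring
  · refine finSupp_ext fun n => ?_
    rw [comp_sub, comp_cutoff, comp_cutoff, comp_lower, comp_lower, hK, comp_cutoff, map_smul,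
      smul_smul, ← sub_smul]
    congr 1
    rw [← Complex.ofReal_mul, ← Complex.ofReal_sub]
    congr 1
    unfold cutoffWeight
    push_cast
    field_simp
    ring
  · exact squeeze_zero (fun k => (K k).opNorm_nonneg)
      (fun k => LinearMap.mkContinuous_norm_le _ (by positivity) _) (tendsto_const_div_sqrt M)

/-- Here w(n+1) − w(n) = −w(n+1)/(n+k+1), so K_k has components −d_n/(n+k+1) and X F_k = −(k+1)K_k.
-/
theorem isRegular_raise {d : ∀ n, G n →L[ℂ] G (n + 1)} {M : ℝ} (hM : 0 ≤ M)
    (hd : ∀ n x, ‖d n x‖ ≤ √((n : ℝ) + 1) * M * ‖x‖) :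
    IsRegular (V := finSupp G) (cutoff G) (raise d) := by
  let κ : ∀ k n : ℕ, G n →L[ℂ] G (n + 1) := fun k n => ((-((n : ℝ) + k + 1)⁻¹ : ℝ) : ℂ) • d n
  have hκ : ∀ k Ψ, ‖raise (κ k) Ψ‖ ≤ 1 / √((k : ℝ) + 1) * M * ‖Ψ‖ := fun k =>
    norm_raise_le (by positivity) fun n x => norm_ofReal_smul_le (hd n x)
      (by rw [abs_neg, abs_of_pos (by positivity), inv_mul_eq_div]; exact sqrt_div_le k n) hM (norm_nonneg x)
  let K : ℕ → finSupp G →L[ℂ] finSupp G := fun k => (raise (κ k)).mkContinuous _ (hκ k)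
  have hK₀ : ∀ k Ψ, comp (K k Ψ) 0 = 0 := fun k Ψ => rfl
  have hK : ∀ k Ψ n, comp (K k Ψ) (n + 1) = ((-((n : ℝ) + k + 1)⁻¹ : ℝ) : ℂ) • d n (comp Ψ n) :=
    fun k Ψ n => rfl
  refine ⟨fun k => ⟨-((k : ℂ) + 1) • K k, fun Ψ => ?_⟩, K, fun k Ψ => ?_, ?_⟩
  · refine finSupp_ext fun n => ?_
    rw [smul_apply, comp_smul]
    cases n with
    | zero => rw [comp_raise_zero, hK₀, smul_zero]
    | succ n =>
      rw [hK, comp_raise_succ, comp_cutoff, map_smul, smul_smul]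
      congr 1
      unfold cutoffWeight
      push_cast
      ring
  · refine finSupp_ext fun n => ?_
    rw [comp_sub, comp_cutoff, comp_cutoff]
    cases n with
    | zero => rw [comp_raise_zero, comp_raise_zero, hK₀, smul_zero, sub_zero]
    | succ n =>
      rw [hK, comp_raise_succ, comp_raise_succ, comp_cutoff, map_smul, smul_smul, ← sub_smul]
      congr 1
      rw [← Complex.ofReal_mul, ← Complex.ofReal_sub]
      congr 1
      unfold cutoffWeight
      push_cast
      field_simp
      ring
  · exact squeeze_zero (fun k => (K k).opNorm_nonneg)
      (fun k => LinearMap.mkContinuous_norm_le _ (by positivity) _) (tendsto_const_div_sqrt M)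

theorem dense_finSupp : Dense (finSupp G : Set (lp G 2)) := by
  intro Ψ
  refine mem_closure_of_tendsto (lp.hasSum_single (by norm_num) Ψ) (Eventually.of_forall fun s => ?_)
  refine Submodule.sum_mem _ fun n _ => ?_
  refine (Set.finite_singleton n).subset fun m hm => ?_
  by_contra hmn
  refine hm ?_
  change ‖lp.single (E := G) 2 n (Ψ n) m‖ = 0
  rw [lp.single_apply_ne _ _ _ hmn, norm_zero]

end HilbertSum

/-! ### Cutoffs and regular operators on tensor products -/

namespace WeakGraph

open Filter Topology

variable {E F : Type*} [NormedAddCommGroup E] [InnerProductSpace ℂ E]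
  [NormedAddCommGroup F] [InnerProductSpace ℂ F]

/-- To check a sesquilinear identity on a tensor product it suffices to consider pure tensors. -/
theorem formalAdjoint_of_tmul {X X' : E ⊗[ℂ] F →ₗ[ℂ] E ⊗[ℂ] F}
    (hX : ∀ x y x' y', ⟪X (x ⊗ₜ y), x' ⊗ₜ[ℂ] y'⟫_ℂ = ⟪x ⊗ₜ[ℂ] y, X' (x' ⊗ₜ y')⟫_ℂ) :
    FormalAdjoint X X' := by
  intro s t
  induction s using TensorProduct.induction_on with
  | zero => rw [map_zero, inner_zero_left, inner_zero_left]
  | add s s' hs hs' => rw [map_add, inner_add_left, inner_add_left, hs, hs']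
  | tmul x y =>
    induction t using TensorProduct.induction_on with
    | zero => rw [map_zero, inner_zero_right, inner_zero_right]
    | add t t' ht ht' => rw [map_add, inner_add_right, inner_add_right, ht, ht']
    | tmul x' y' => exact hX x y x' y'

theorem FormalAdjoint.rTensor {X X' : E →ₗ[ℂ] E} (hX : FormalAdjoint X X') :
    FormalAdjoint (X.rTensor F) (X'.rTensor F) :=
  formalAdjoint_of_tmul fun x y x' y' => by
    rw [LinearMap.rTensor_tmul, LinearMap.rTensor_tmul, TensorProduct.inner_tmul,
      TensorProduct.inner_tmul, hX]

theorem FormalAdjoint.lTensor {X X' : F →ₗ[ℂ] F} (hX : FormalAdjoint X X') :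
    FormalAdjoint (X.lTensor E) (X'.lTensor E) :=
  formalAdjoint_of_tmul fun x y x' y' => by
    rw [LinearMap.lTensor_tmul, LinearMap.lTensor_tmul, TensorProduct.inner_tmul,
      TensorProduct.inner_tmul, hX]

/-- The core is the algebraic tensor product, so strong convergence and surjectivity reduce to pure
tensors. -/
theorem IsCutoff.mapL {P : ℕ → E →L[ℂ] E} {Q : ℕ → F →L[ℂ] F} (hP : IsCutoff P)
    (hQ : IsCutoff Q) : IsCutoff fun k => TensorProduct.mapL (P k) (Q k) where
  norm_le k := (TensorProduct.norm_mapL_le _ _).trans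
    (mul_le_one₀ (hP.norm_le k) (norm_nonneg _) (hQ.norm_le k))
  symmetric k := formalAdjoint_of_tmul (X := (TensorProduct.mapL (P k) (Q k)).toLinearMap)
    (X' := (TensorProduct.mapL (P k) (Q k)).toLinearMap) fun x y x' y' => by
      change ⟪P k x ⊗ₜ[ℂ] Q k y, _⟫_ℂ = ⟪_, P k x' ⊗ₜ[ℂ] Q k y'⟫_ℂ
      rw [TensorProduct.inner_tmul, TensorProduct.inner_tmul, hP.symmetric, hQ.symmetric]
  tendsto x := by
    induction x using TensorProduct.induction_on with
    | zero => simp only [map_zero, tendsto_const_nhds]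
    | add s t hs ht => simpa only [map_add] using hs.add ht
    | tmul x y =>
      simp only [TensorProduct.mapL_tmul]
      exact (TensorProduct.continuous_tmul.tendsto (x, y)).comp
        ((hP.tendsto x).prodMk_nhds (hQ.tendsto y))
  surjective k := by
    have h1 : Function.Surjective (TensorProduct.map (P k).toLinearMap (Q k).toLinearMap) :=
      TensorProduct.map_surjective (hP.surjective k) (hQ.surjective k)
    exact fun x => (h1 x).imp fun y hy => by rw [TensorProduct.mapL_apply, hy]

theorem tensor_clm_ext {X : E ⊗[ℂ] F →ₗ[ℂ] E ⊗[ℂ] F} {Y : E ⊗[ℂ] F →ₗ[ℂ] E ⊗[ℂ] F}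
    (hXY : ∀ x y, X (x ⊗ₜ y) = Y (x ⊗ₜ y)) (t : E ⊗[ℂ] F) : X t = Y t :=
  DFunLike.congr_fun (TensorProduct.ext' hXY) t

/-- The commutator factors as [P, X] ⊗ Q = PK ⊗ Q = (P ⊗ Q)(K ⊗ 1). Having the cutoff on the left in
`IsRegular` makes this work. -/
theorem IsRegular.rTensor {P : ℕ → E →L[ℂ] E} {Q : ℕ → F →L[ℂ] F} {X : E →ₗ[ℂ] E}
    (hX : IsRegular P X) : IsRegular (fun k => TensorProduct.mapL (P k) (Q k)) (X.rTensor F) := by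
  obtain ⟨hX₁, K, hK, hK₀⟩ := hX
  refine ⟨fun k => ?_, fun k => (K k).rTensor F, fun k => ?_, ?_⟩
  · obtain ⟨B, hB⟩ := hX₁ k
    refine ⟨TensorProduct.mapL B (Q k), tensor_clm_ext
      (X := X.rTensor F ∘ₗ (TensorProduct.mapL (P k) (Q k)).toLinearMap)
      (Y := (TensorProduct.mapL B (Q k)).toLinearMap) fun x y => ?_⟩
    change X (P k x) ⊗ₜ[ℂ] Q k y = B x ⊗ₜ[ℂ] Q k y
    rw [hB]
  · refine tensor_clm_ext
      (X := (TensorProduct.mapL (P k) (Q k)).toLinearMap ∘ₗ X.rTensor F -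
        X.rTensor F ∘ₗ (TensorProduct.mapL (P k) (Q k)).toLinearMap)
      (Y := (TensorProduct.mapL (P k) (Q k)).toLinearMap ∘ₗ ((K k).rTensor F).toLinearMap)
      fun x y => ?_
    change P k (X x) ⊗ₜ[ℂ] Q k y - X (P k x) ⊗ₜ[ℂ] Q k y = P k (K k x) ⊗ₜ[ℂ] Q k y
    rw [← hK, TensorProduct.sub_tmul]
  · exact squeeze_zero (fun _ => norm_nonneg _) (fun k => ContinuousLinearMap.norm_rTensor_le (G := F) (K k)) hK₀

theorem IsRegular.lTensor {P : ℕ → E →L[ℂ] E} {Q : ℕ → F →L[ℂ] F} {X : F →ₗ[ℂ] F}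
    (hX : IsRegular Q X) : IsRegular (fun k => TensorProduct.mapL (P k) (Q k)) (X.lTensor E) := by
  obtain ⟨hX₁, K, hK, hK₀⟩ := hX
  refine ⟨fun k => ?_, fun k => (K k).lTensor E, fun k => ?_, ?_⟩
  · obtain ⟨B, hB⟩ := hX₁ k
    refine ⟨TensorProduct.mapL (P k) B, tensor_clm_ext
      (X := X.lTensor E ∘ₗ (TensorProduct.mapL (P k) (Q k)).toLinearMap)
      (Y := (TensorProduct.mapL (P k) B).toLinearMap) fun x y => ?_⟩
    change P k x ⊗ₜ[ℂ] X (Q k y) = P k x ⊗ₜ[ℂ] B y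
    rw [hB]
  · refine tensor_clm_ext
      (X := (TensorProduct.mapL (P k) (Q k)).toLinearMap ∘ₗ X.lTensor E -
        X.lTensor E ∘ₗ (TensorProduct.mapL (P k) (Q k)).toLinearMap)
      (Y := (TensorProduct.mapL (P k) (Q k)).toLinearMap ∘ₗ ((K k).lTensor E).toLinearMap)
      fun x y => ?_
    change P k x ⊗ₜ[ℂ] Q k (X y) - P k x ⊗ₜ[ℂ] X (Q k y) = P k x ⊗ₜ[ℂ] Q k (K k y)
    rw [← hK, TensorProduct.tmul_sub]
  · exact squeeze_zero (fun _ => norm_nonneg _) (fun k => ContinuousLinearMap.norm_lTensor_le (G := E) (K k)) hK₀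

/-! ### Abelian algebras generated by regular operators -/

variable {V H : Type*} [NormedAddCommGroup V] [InnerProductSpace ℂ V]
  [NormedAddCommGroup H] [InnerProductSpace ℂ H] [CompleteSpace H]

/-- The hermitian part of `2θZ`. -/
def field (Z Z' : V →ₗ[ℂ] V) (θ : ℂ) : V →ₗ[ℂ] V := θ • Z + star θ • Z'

theorem field_symmetric {Z Z' : V →ₗ[ℂ] V} (hZ : FormalAdjoint Z Z') (θ : ℂ) :
    FormalAdjoint (field Z Z' θ) (field Z Z' θ) := by
  have h1 := (hZ.smul θ).add (hZ.symm.smul (star θ))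
  rw [star_star, add_comm (star θ • Z')] at h1
  exact h1

theorem field_isRegular {F : ℕ → V →L[ℂ] V} {Z Z' : V →ₗ[ℂ] V} (hZ : IsRegular F Z)
    (hZ' : IsRegular F Z') (θ : ℂ) : IsRegular F (field Z Z' θ) :=
  (hZ.smul θ).add (hZ'.smul (star θ))

/-- A bounded operator preserving the graphs of the fields of `Z` preserves the graph of `Z`. -/
theorem mem_weakGraph_of_field {ι : V →ₗᵢ[ℂ] H} (hι : DenseRange ι) {F : ℕ → V →L[ℂ] V}
    (hF : IsCutoff F) {Z Z' : V →ₗ[ℂ] V} (hZZ' : FormalAdjoint Z Z') (hZ : IsRegular F Z)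
    (hZ' : IsRegular F Z') {T : H →L[ℂ] H}
    (hT : ∀ θ, ∀ p ∈ weakGraph ι (field Z Z' θ), (T p.1, T p.2) ∈ weakGraph ι (field Z Z' θ))
    {p : H × H} (hp : p ∈ weakGraph ι Z') : (T p.1, T p.2) ∈ weakGraph ι Z' := by
  have hp' := weakGraph_subset_closure hι hF hZZ' hZ hZ' hp
  refine closure_minimal (s := strongGraph ι Z) (t := {p | (T p.1, T p.2) ∈ weakGraph ι Z'})
    ?_ ((isClosed_weakGraph ι Z').preimage (by fun_prop)) hp'
  rintro _ ⟨x, rfl⟩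
  intro d
  -- With X_θ = θZ + θ̄Z', one has Z = ½(X_1 − iX_i). The two weak identities can be added because
  -- both are tested on core vectors.
  have h1 := hT 1 _ ((field_symmetric hZZ' 1).mem_weakGraph x) d
  have h2 := hT Complex.I _ ((field_symmetric hZZ' Complex.I).mem_weakGraph x) d
  simp only [field, LinearMap.add_apply, LinearMap.smul_apply, map_add, map_smul, inner_add_left,
    inner_add_right, inner_smul_left, inner_smul_right, star_one, RCLike.star_def, Complex.conj_I,
    map_one, map_neg] at h1 h2
  linear_combination (1 / 2) * h1 + (Complex.I / 2) * h2 + (1 / 2) *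
    (⟪T (ι x), ι (Z' d)⟫_ℂ - ⟪T (ι x), ι (Z d)⟫_ℂ + ⟪T (ι (Z' x)), ι d⟫_ℂ -
      ⟪T (ι (Z x)), ι d⟫_ℂ) * Complex.I_sq

/-- Operators whose graphs are the closures of regular, mutually commuting `Z j` (which also
commute with one another's formal adjoints) generate an abelian von Neumann algebra. -/
theorem commute_of_mem_generated {J : Type*} {ι : V →ₗᵢ[ℂ] H} (hι : DenseRange ι)
    {F : ℕ → V →L[ℂ] V} (hF : IsCutoff F) {Z Z' : J → V →ₗ[ℂ] V}
    (hZZ' : ∀ j, FormalAdjoint (Z j) (Z' j)) (hZ : ∀ j, IsRegular F (Z j))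
    (hZ' : ∀ j, IsRegular F (Z' j)) (hc : ∀ i j x, Z i (Z j x) = Z j (Z i x))
    (hc' : ∀ i j x, Z i (Z' j x) = Z' j (Z i x)) (hc'' : ∀ i j x, Z' i (Z' j x) = Z' j (Z' i x))
    {N : J → H →ₗ.[ℂ] H} (hN : ∀ j, (N j).graph = weakGraph ι (Z' j)) {S T : H →L[ℂ] H}
    (hS : S ∈ generatedVonNeumannAlgebra (Set.range N))
    (hT : T ∈ generatedVonNeumannAlgebra (Set.range N)) : S * T = T * S := by
  let X : J × ℂ → V →ₗ[ℂ] V := fun q => field (Z q.1) (Z' q.1) q.2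
  have hX : ∀ q, FormalAdjoint (X q) (X q) := fun q => field_symmetric (hZZ' q.1) q.2
  have hXr : ∀ q, IsRegular F (X q) := fun q => field_isRegular (hZ q.1) (hZ' q.1) q.2
  have hXc : ∀ q r x, X q (X r x) = X r (X q x) := by
    intro q r x
    simp only [X, field, LinearMap.add_apply, LinearMap.smul_apply, map_add, map_smul, smul_add,
      hc q.1 r.1, hc' q.1 r.1, ← hc' r.1 q.1, hc'' q.1 r.1, smul_smul, mul_comm r.2,
      mul_comm (star r.2)]
    abel
  let W : Set (H →L[ℂ] H) := Set.range fun q => resolvent hι hF (hX q) (hXr q)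
  have hW : W ⊆ Set.centralizer W := by
    rintro _ ⟨q, rfl⟩ _ ⟨r, rfl⟩
    exact resolvent_commute hι hF (hX r) (hXr r) (hX q) (hXr q) (hXc r q)
  have hcomm : ∀ (j : J) (R : H →L[ℂ] H),
      (∀ p ∈ weakGraph ι (Z' j), (R p.1, R p.2) ∈ weakGraph ι (Z' j)) → CommutesWith R (N j) := by
    intro j R hR x
    have h1 := hR (x, N j x) (by rw [← hN]; exact (N j).mem_graph x)
    rw [← hN, LinearPMap.mem_graph_iff] at h1
    obtain ⟨y, hy₁, hy₂⟩ := h1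
    change (y : H) = R x at hy₁
    refine ⟨by rw [← hy₁]; exact y.2, ?_⟩
    change N j y = R (N j x) at hy₂
    rw [← hy₂]
    congr 1
    exact Subtype.ext hy₁.symm
  -- `W` is not assumed closed under adjoints; the condition on `star R` comes from
  -- `star_mem_weakGraph` instead.
  have hsub : Set.centralizer W ⊆ unboundedCommutant (Set.range N) := by
    rintro R hR _ ⟨j, rfl⟩
    have hRX : ∀ θ, ∀ p ∈ weakGraph ι (X (j, θ)), (R p.1, R p.2) ∈ weakGraph ι (X (j, θ)) :=
      fun θ p hp => mem_weakGraph_of_commute hι hF (hX (j, θ)) (hXr (j, θ)) (hR _ ⟨(j, θ), rfl⟩) hp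
    refine ⟨hcomm j R fun p hp => ?_, hcomm j (star R) fun p hp => ?_⟩
    · exact mem_weakGraph_of_field hι hF (hZZ' j) (hZ j) (hZ' j) hRX hp
    · exact mem_weakGraph_of_field hι hF (hZZ' j) (hZ j) (hZ' j)
        (fun θ p hp => star_mem_weakGraph (hX (j, θ)) hι hF (hXr (j, θ)) (hRX θ) hp) hp
  have hS' : S ∈ Set.centralizer (Set.centralizer W) := Set.centralizer_subset hsub hS
  have hT' : T ∈ Set.centralizer (Set.centralizer W) := Set.centralizer_subset hsub hT
  -- From W ⊆ W' follows W'' ⊆ W', so S lies in W' while T lies in W''.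
  exact hT' S (Set.centralizer_subset hW hS')

end WeakGraph

/-! ### Closures of operators with a regular core -/

namespace WeakGraph

variable {V H : Type*} [NormedAddCommGroup V] [InnerProductSpace ℂ V]
  [NormedAddCommGroup H] [InnerProductSpace ℂ H]

/-- The partially defined operator `N` extends `X`, and its adjoint extends `X'`, where `X` and
`X'` are regular formal adjoints of one another. -/
structure HasRegularCore (ι : V →ₗᵢ[ℂ] H) (F : ℕ → V →L[ℂ] V) (N : H →ₗ.[ℂ] H)
    (X X' : V →ₗ[ℂ] V) : Prop where
  denseRange : DenseRange ι
  isCutoff : IsCutoff F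
  mem_domain : ∀ u, ι u ∈ N.domain
  apply_eq : ∀ u, N ⟨ι u, mem_domain u⟩ = ι (X u)
  inner_apply : ∀ (x : N.domain) u, ⟪N x, ι u⟫_ℂ = ⟪(x : H), ι (X' u)⟫_ℂ
  formalAdjoint : FormalAdjoint X X'
  isRegular : IsRegular F X
  isRegular_adjoint : IsRegular F X'

namespace HasRegularCore

variable {ι : V →ₗᵢ[ℂ] H} {F : ℕ → V →L[ℂ] V} {N : H →ₗ.[ℂ] H} {X X' : V →ₗ[ℂ] V}

theorem dense_domain (hN : HasRegularCore ι F N X X') : Dense (N.domain : Set H) := by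
  refine Dense.mono ?_ hN.denseRange
  rintro _ ⟨u, rfl⟩
  exact hN.mem_domain u

theorem inner_apply_right (hN : HasRegularCore ι F N X X') (u : V) (x : N.domain) :
    ⟪ι (X' u), (x : H)⟫_ℂ = ⟪ι u, N x⟫_ℂ := by
  rw [← inner_conj_symm, ← hN.inner_apply, inner_conj_symm]

variable [CompleteSpace H]

/-- One inclusion says that the adjoint of N extends X'; the other is weak = strong for X, whose
graph lies in that of N. -/
theorem closure_graph (hN : HasRegularCore ι F N X X') :
    N.graph.topologicalClosure = weakGraph ι X' := by
  refine le_antisymm ?_ ?_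
  · refine Submodule.topologicalClosure_minimal _ ?_ (isClosed_weakGraph _ _)
    rintro ⟨y, w⟩ hyw
    obtain ⟨x, rfl, rfl⟩ := (LinearPMap.mem_graph_iff _).1 hyw
    exact fun d => (hN.inner_apply x d).symm
  · refine (weakGraph_subset_closure hN.denseRange hN.isCutoff hN.formalAdjoint hN.isRegular
      hN.isRegular_adjoint).trans (closure_mono ?_)
    rintro _ ⟨u, rfl⟩
    exact (LinearPMap.mem_graph_iff _).2 ⟨⟨_, hN.mem_domain u⟩, rfl, hN.apply_eq u⟩

/-- The closure of the graph is a weak graph, which is single-valued because the core is dense. -/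
theorem isClosable (hN : HasRegularCore ι F N X X') : N.IsClosable := by
  refine ⟨(weakGraph ι X').toLinearPMap, ?_⟩
  rw [hN.closure_graph, Submodule.toLinearPMap_graph_eq]
  rintro ⟨y, w⟩ hyw (rfl : y = 0)
  refine eq_of_inner_dense hN.denseRange fun d => ?_
  rw [← hyw d]
  simp only [inner_zero_left]

theorem graph_closure (hN : HasRegularCore ι F N X X') : N.closure.graph = weakGraph ι X' := by
  rw [← hN.isClosable.graph_closure_eq_closure_graph, hN.closure_graph]

theorem mem_adjoint_domain (hN : HasRegularCore ι F N X X') (u : V) : ι u ∈ N.adjoint.domain :=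
  LinearPMap.mem_adjoint_domain_of_exists _ ⟨_, hN.inner_apply_right u⟩

theorem adjoint_apply_eq (hN : HasRegularCore ι F N X X') (u : V) :
    N.adjoint ⟨ι u, hN.mem_adjoint_domain u⟩ = ι (X' u) :=
  LinearPMap.adjoint_apply_eq hN.dense_domain ⟨_, hN.mem_adjoint_domain u⟩ (hN.inner_apply_right u)

/-- If `X` and `Y'` commute on the core, then so do `N` and the adjoint of `M`. -/
theorem adjoint_comm (hN : HasRegularCore ι F N X X') {M : H →ₗ.[ℂ] H} {Y Y' : V →ₗ[ℂ] V}
    (hM : HasRegularCore ι F M Y Y') (hc : ∀ u, X (Y' u) = Y' (X u)) (u : V) :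
    ∃ (h₁ : ι u ∈ N.domain) (h₂ : ι u ∈ M.adjoint.domain)
      (h₃ : N ⟨ι u, h₁⟩ ∈ M.adjoint.domain) (h₄ : M.adjoint ⟨ι u, h₂⟩ ∈ N.domain),
      N ⟨_, h₄⟩ = M.adjoint ⟨_, h₃⟩ := by
  refine ⟨hN.mem_domain u, hM.mem_adjoint_domain u, ?_, ?_, ?_⟩
  · rw [hN.apply_eq]
    exact hM.mem_adjoint_domain _
  · rw [hM.adjoint_apply_eq]
    exact hN.mem_domain _
  · simp only [hN.apply_eq, hM.adjoint_apply_eq, hc]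

end HasRegularCore

end WeakGraph

/-! ### Tensor products of operators on dense subspaces -/

section TensorOperators

variable {E F U W : Type*} [NormedAddCommGroup E] [InnerProductSpace ℂ E]
  [NormedAddCommGroup F] [InnerProductSpace ℂ F] [NormedAddCommGroup U] [InnerProductSpace ℂ U]
  [NormedAddCommGroup W] [InnerProductSpace ℂ W]

/-- The tensor product of two isometries, with values in the Hilbert space tensor product. -/
def tensorIsometry (j : U →ₗᵢ[ℂ] E) (k : W →ₗᵢ[ℂ] F) : (U ⊗[ℂ] W) →ₗᵢ[ℂ] HilbertTensor E F :=
  UniformSpace.Completion.toComplₗᵢ.comp (TensorProduct.mapIsometry j k)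

theorem denseRange_tensorIsometry {j : U →ₗᵢ[ℂ] E} {k : W →ₗᵢ[ℂ] F}
    (hj : DenseRange j) (hk : DenseRange k) : DenseRange (tensorIsometry j k) := by
  refine UniformSpace.Completion.denseRange_coe.comp (f := TensorProduct.mapIsometry j k) ?_
    (UniformSpace.Completion.continuous_coe _)
  intro t
  change t ∈ closure (LinearMap.range (TensorProduct.map j.toLinearMap k.toLinearMap) :
    Set (E ⊗[ℂ] F))
  rw [← Submodule.topologicalClosure_coe]
  induction t using TensorProduct.induction_on with
  | zero => exact Submodule.zero_mem _
  | add s t hs ht => exact Submodule.add_mem _ hs ht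
  | tmul x y =>
    have h1 : (x, y) ∈ closure (Set.range j ×ˢ Set.range k) := by
      rw [closure_prod_eq]
      exact ⟨hj x, hk y⟩
    refine map_mem_closure (f := fun z : E × F => z.1 ⊗ₜ[ℂ] z.2) TensorProduct.continuous_tmul h1 ?_
    rintro ⟨_, _⟩ ⟨⟨x, rfl⟩, ⟨y, rfl⟩⟩
    exact ⟨x ⊗ₜ y, rfl⟩

theorem tensorOp_tensorIncl (S : E →ₗ.[ℂ] E) (T : F →ₗ.[ℂ] F) (t : S.domain ⊗[ℂ] T.domain)
    (ht : tensorIncl S.domain T.domain t ∈ (tensorOp S T).domain) :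
    tensorOp S T ⟨_, ht⟩ = ((TensorProduct.map S.toFun T.toFun t : E ⊗[ℂ] F) : HilbertTensor E F) := by
  have h1 : (LinearEquiv.ofInjective _ (tensorIncl_injective S.domain T.domain)).symm ⟨_, ht⟩ = t := by
    rw [LinearEquiv.symm_apply_eq]
    rfl
  change ((TensorProduct.map S.toFun T.toFun
    ((LinearEquiv.ofInjective _ (tensorIncl_injective S.domain T.domain)).symm ⟨_, ht⟩) :
      E ⊗[ℂ] F) : HilbertTensor E F) = _
  rw [h1]

/-- On the tensor product of subspaces preserved by `S` and `T`, the operator `S ⊗ T` is the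
algebraic tensor product of the restrictions. -/
theorem exists_tensorOp_apply {S : E →ₗ.[ℂ] E} {T : F →ₗ.[ℂ] F} {j : U →ₗᵢ[ℂ] E} {k : W →ₗᵢ[ℂ] F}
    {a : U →ₗ[ℂ] U} {b : W →ₗ[ℂ] W} (hj : ∀ x, j x ∈ S.domain) (hk : ∀ y, k y ∈ T.domain)
    (ha : ∀ x, S ⟨j x, hj x⟩ = j (a x)) (hb : ∀ y, T ⟨k y, hk y⟩ = k (b y)) (u : U ⊗[ℂ] W) :
    ∃ hu : tensorIsometry j k u ∈ (tensorOp S T).domain,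
      tensorOp S T ⟨_, hu⟩ = tensorIsometry j k (TensorProduct.map a b u) := by
  let j' : U →ₗ[ℂ] S.domain := j.toLinearMap.codRestrict S.domain hj
  let k' : W →ₗ[ℂ] T.domain := k.toLinearMap.codRestrict T.domain hk
  have h1 : tensorIsometry j k u = tensorIncl S.domain T.domain (TensorProduct.map j' k' u) := by
    have : (tensorIsometry j k).toLinearMap =
        tensorIncl S.domain T.domain ∘ₗ TensorProduct.map j' k' :=
      TensorProduct.ext' fun x y => rfl
    exact DFunLike.congr_fun this u
  have h2 : tensorIncl S.domain T.domain (TensorProduct.map j' k' u) ∈ (tensorOp S T).domain :=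
    ⟨_, rfl⟩
  have h4 : TensorProduct.map S.toFun T.toFun ∘ₗ TensorProduct.map j' k' =
      TensorProduct.map j.toLinearMap k.toLinearMap ∘ₗ TensorProduct.map a b := by
    refine TensorProduct.ext' fun x y => ?_
    change S ⟨j x, hj x⟩ ⊗ₜ[ℂ] T ⟨k y, hk y⟩ = j (a x) ⊗ₜ[ℂ] k (b y)
    rw [ha, hb]
  simp only [h1]
  refine ⟨h2, (tensorOp_tensorIncl S T _ h2).trans ?_⟩
  exact congrArg (fun t : E ⊗[ℂ] F => (t : HilbertTensor E F)) (DFunLike.congr_fun h4 u)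

theorem inner_tensorOp_apply {S : E →ₗ.[ℂ] E} {T : F →ₗ.[ℂ] F} {j : U →ₗᵢ[ℂ] E}
    {k : W →ₗᵢ[ℂ] F} {a : U →ₗ[ℂ] U} {b : W →ₗ[ℂ] W}
    (ha : ∀ (x : S.domain) d, ⟪S x, j d⟫_ℂ = ⟪(x : E), j (a d)⟫_ℂ)
    (hb : ∀ (y : T.domain) e, ⟪T y, k e⟫_ℂ = ⟪(y : F), k (b e)⟫_ℂ)
    (x : (tensorOp S T).domain) (u : U ⊗[ℂ] W) :
    ⟪tensorOp S T x, tensorIsometry j k u⟫_ℂ =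
      ⟪(x : HilbertTensor E F), tensorIsometry j k (TensorProduct.map a b u)⟫_ℂ := by
  obtain ⟨_, t, rfl⟩ := x
  refine (congrArg (fun z => ⟪z, tensorIsometry j k u⟫_ℂ)
    (tensorOp_tensorIncl S T t ⟨t, rfl⟩)).trans ?_
  refine (UniformSpace.Completion.inner_coe _ _).trans ?_
  refine Eq.trans ?_ (UniformSpace.Completion.inner_coe _ _).symm
  change ⟪TensorProduct.map S.toFun T.toFun t, TensorProduct.map j.toLinearMap k.toLinearMap u⟫_ℂ =
    ⟪TensorProduct.mapIncl S.domain T.domain t,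
      TensorProduct.map j.toLinearMap k.toLinearMap (TensorProduct.map a b u)⟫_ℂ
  induction t using TensorProduct.induction_on with
  | zero => rw [map_zero, map_zero, inner_zero_left, inner_zero_left]
  | add s s' hs hs' => rw [map_add, map_add, inner_add_left, inner_add_left, hs, hs']
  | tmul x y =>
    induction u using TensorProduct.induction_on with
    | zero => rw [map_zero, map_zero, map_zero, inner_zero_right, inner_zero_right]
    | add t t' ht ht' =>
      rw [map_add, map_add, map_add, inner_add_right, inner_add_right, ht, ht']
    | tmul x' y' =>
      change ⟪S x ⊗ₜ[ℂ] T y, j x' ⊗ₜ[ℂ] k y'⟫_ℂ =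
        ⟪(x : E) ⊗ₜ[ℂ] (y : F), j (a x') ⊗ₜ[ℂ] k (b y')⟫_ℂ
      rw [TensorProduct.inner_tmul, TensorProduct.inner_tmul, ha, hb]

end TensorOperators

/-! ### Fields on the tensor product of two representations of the commutation relations -/

section Fields

open WeakGraph

variable {E U I : Type*} [NormedAddCommGroup E] [InnerProductSpace ℂ E]
  [NormedAddCommGroup U] [InnerProductSpace ℂ U]

/-- Annihilation operators `A i` and creation operators `C i` satisfying the canonical commutation
relations with covariance `g` on a dense subspace, where they restrict to `a i` and `c i`. -/
structure IsCCRRep (g : I → I → ℂ) (j : U →ₗᵢ[ℂ] E) (P : ℕ → U →L[ℂ] U)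
    (A C : I → E →ₗ.[ℂ] E) (a c : I → U →ₗ[ℂ] U) : Prop where
  denseRange : DenseRange j
  isCutoff : IsCutoff P
  mem_annihilation : ∀ i x, j x ∈ (A i).domain
  mem_creation : ∀ i x, j x ∈ (C i).domain
  annihilation_apply : ∀ i x, A i ⟨j x, mem_annihilation i x⟩ = j (a i x)
  creation_apply : ∀ i x, C i ⟨j x, mem_creation i x⟩ = j (c i x)
  inner_annihilation : ∀ i (x : (A i).domain) d, ⟪A i x, j d⟫_ℂ = ⟪(x : E), j (c i d)⟫_ℂ
  inner_creation : ∀ i (x : (C i).domain) d, ⟪C i x, j d⟫_ℂ = ⟪(x : E), j (a i d)⟫_ℂ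
  formalAdjoint : ∀ i, FormalAdjoint (c i) (a i)
  isRegular_annihilation : ∀ i, IsRegular P (a i)
  isRegular_creation : ∀ i, IsRegular P (c i)
  annihilation_comm : ∀ i k x, a i (a k x) = a k (a i x)
  creation_comm : ∀ i k x, c i (c k x) = c k (c i x)
  ccr : ∀ i k x, a i (c k x) = g i k • x + c k (a i x)

/-- The field `A i ⊗ I + I ⊗ C (J i)`. -/
def tensorField (A C : I → E →ₗ.[ℂ] E) (J : I → I) (i : I) :
    HilbertTensor E E →ₗ.[ℂ] HilbertTensor E E :=
  tensorOp (A i) (idOp E) + tensorOp (idOp E) (C (J i))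

/-- The algebraic field `a i ⊗ I + I ⊗ c (J i)` on a dense subspace. -/
def algField (a c : I → U →ₗ[ℂ] U) (J : I → I) (i : I) : U ⊗[ℂ] U →ₗ[ℂ] U ⊗[ℂ] U :=
  (a i).rTensor U + (c (J i)).lTensor U

theorem algField_tmul (a c : I → U →ₗ[ℂ] U) (J : I → I) (i : I) (x y : U) :
    algField a c J i (x ⊗ₜ y) = a i x ⊗ₜ[ℂ] y + x ⊗ₜ[ℂ] c (J i) y := rfl

/-- Annihilators and creators act on different factors, so no mixed commutation relation enters.
Exchanging `a` and `c` gives the same result for the formal adjoints. -/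
theorem algField_comm {a c : I → U →ₗ[ℂ] U}
    (ha : ∀ i k x, a i (a k x) = a k (a i x)) (hc : ∀ i k x, c i (c k x) = c k (c i x))
    (J : I → I) (i k : I) (t : U ⊗[ℂ] U) :
    algField a c J i (algField a c J k t) = algField a c J k (algField a c J i t) := by
  refine DFunLike.congr_fun (f := algField a c J i ∘ₗ algField a c J k)
    (g := algField a c J k ∘ₗ algField a c J i) (TensorProduct.ext' fun x y => ?_) t
  rw [LinearMap.comp_apply, LinearMap.comp_apply]
  simp only [algField_tmul, map_add, ha i k, hc (J i) (J k)]
  abel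

namespace IsCCRRep

variable {g : I → I → ℂ} {j : U →ₗᵢ[ℂ] E} {P : ℕ → U →L[ℂ] U} {A C : I → E →ₗ.[ℂ] E}
  {a c : I → U →ₗ[ℂ] U}

/-- The first factor contributes [a_i, c_k] = g(i,k), the second [c_{Ji}, a_{Jk}] = −g(Jk, Ji); `hJ`
makes them cancel. -/
theorem algField_comm_adjoint (hR : IsCCRRep g j P A C a c) {J : I → I}
    (hJ : ∀ i k, g (J k) (J i) = g i k) (i k : I) (t : U ⊗[ℂ] U) :
    algField a c J i (algField c a J k t) = algField c a J k (algField a c J i t) := by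
  refine DFunLike.congr_fun (f := algField a c J i ∘ₗ algField c a J k)
    (g := algField c a J k ∘ₗ algField a c J i) (TensorProduct.ext' fun x y => ?_) t
  rw [LinearMap.comp_apply, LinearMap.comp_apply]
  simp only [algField_tmul, map_add, hR.ccr, hJ, TensorProduct.add_tmul, TensorProduct.tmul_add,
    TensorProduct.tmul_smul, ← TensorProduct.smul_tmul']
  abel

theorem hasRegularCore (hR : IsCCRRep g j P A C a c) (J : I → I) (i : I) :
    HasRegularCore (tensorIsometry j j) (fun k => TensorProduct.mapL (P k) (P k))
      (tensorField A C J i) (algField a c J i) (algField c a J i) := by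
  have h1 := exists_tensorOp_apply (S := A i) (T := idOp E) (j := j) (k := j)
    (b := (LinearMap.id : U →ₗ[ℂ] U))
    (hR.mem_annihilation i) (fun _ => Submodule.mem_top) (hR.annihilation_apply i) (fun _ => rfl)
  have h2 := exists_tensorOp_apply (S := idOp E) (T := C (J i)) (j := j) (k := j)
    (a := (LinearMap.id : U →ₗ[ℂ] U))
    (fun _ => Submodule.mem_top) (hR.mem_creation (J i)) (fun _ => rfl) (hR.creation_apply (J i))
  have h3 := inner_tensorOp_apply (S := A i) (T := idOp E) (j := j) (k := j)
    (b := (LinearMap.id : U →ₗ[ℂ] U))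
    (hR.inner_annihilation i) (fun _ _ => rfl)
  have h4 := inner_tensorOp_apply (S := idOp E) (T := C (J i)) (j := j) (k := j)
    (a := (LinearMap.id : U →ₗ[ℂ] U))
    (fun _ _ => rfl) (hR.inner_creation (J i))
  exact
    { denseRange := denseRange_tensorIsometry hR.denseRange hR.denseRange
      isCutoff := hR.isCutoff.mapL hR.isCutoff
      mem_domain := fun u => ⟨(h1 u).1, (h2 u).1⟩
      apply_eq := fun u => by
        rw [algField, LinearMap.add_apply, map_add]
        exact congrArg₂ (· + ·) (h1 u).2 (h2 u).2
      inner_apply := fun x u => by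
        rw [algField, LinearMap.add_apply, map_add, inner_add_right]
        refine Eq.trans ?_ (congrArg₂ (· + ·) (h3 ⟨x, x.2.1⟩ u) (h4 ⟨x, x.2.2⟩ u))
        exact inner_add_left _ _ _
      formalAdjoint := (hR.formalAdjoint i).symm.rTensor.add (hR.formalAdjoint (J i)).lTensor
      isRegular := (hR.isRegular_annihilation i).rTensor.add (hR.isRegular_creation (J i)).lTensor
      isRegular_adjoint :=
        (hR.isRegular_creation i).rTensor.add (hR.isRegular_annihilation (J i)).lTensor }

/-- The fields commute with one another's adjoints on the algebraic tensor product. -/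
theorem tensorField_adjoint_comm (hR : IsCCRRep g j P A C a c) {J : I → I}
    (hJ : ∀ i k, g (J k) (J i) = g i k) (i k : I) (x : HilbertTensor E E)
    (hx : ∃ u, tensorIsometry j j u = x) :
    ∃ (h₁ : x ∈ (tensorField A C J i).domain)
      (h₂ : x ∈ (tensorField A C J k).adjoint.domain)
      (h₃ : tensorField A C J i ⟨x, h₁⟩ ∈ (tensorField A C J k).adjoint.domain)
      (h₄ : (tensorField A C J k).adjoint ⟨x, h₂⟩ ∈ (tensorField A C J i).domain),
      tensorField A C J i ⟨_, h₄⟩ = (tensorField A C J k).adjoint ⟨_, h₃⟩ := by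
  obtain ⟨u, rfl⟩ := hx
  exact (hR.hasRegularCore J i).adjoint_comm (hR.hasRegularCore J k)
    (hR.algField_comm_adjoint hJ i k) u

/-- The von Neumann algebra generated by the closures of the fields is abelian. -/
theorem commute_of_mem_generated (hR : IsCCRRep g j P A C a c) {J : I → I}
    (hJ : ∀ i k, g (J k) (J i) = g i k) {S T : HilbertTensor E E →L[ℂ] HilbertTensor E E}
    (hS : S ∈ generatedVonNeumannAlgebra (Set.range fun i => (tensorField A C J i).closure))
    (hT : T ∈ generatedVonNeumannAlgebra (Set.range fun i => (tensorField A C J i).closure)) :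
    S * T = T * S :=
  WeakGraph.commute_of_mem_generated (Z := algField a c J) (Z' := algField c a J)
    (denseRange_tensorIsometry hR.denseRange hR.denseRange) (hR.isCutoff.mapL hR.isCutoff)
    (fun i => (hR.hasRegularCore J i).formalAdjoint) (fun i => (hR.hasRegularCore J i).isRegular)
    (fun i => (hR.hasRegularCore J i).isRegular_adjoint)
    (algField_comm hR.annihilation_comm hR.creation_comm J) (hR.algField_comm_adjoint hJ)
    (algField_comm hR.creation_comm hR.annihilation_comm J)
    (fun i => (hR.hasRegularCore J i).graph_closure) hS hT

end IsCCRRep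

end Fields

/-! ### The Fock representation -/


namespace BoseFock

open WeakGraph HilbertSum

variable {h : Type u} [NormedAddCommGroup h] [InnerProductSpace ℂ h]

theorem symContract_comm (φ ψ : h) (n : ℕ) (x : symPow h (n + 2)) :
    symContract φ n (symContract ψ (n + 1) x) = symContract ψ n (symContract φ (n + 1) x) := by
  refine ext_inner_right ℂ fun y => ?_
  have key : ∀ φ ψ : h, ⟪symContract φ n (symContract ψ (n + 1) x), y⟫_ℂ =
      ⟪x, symInsert ψ (n + 1) (symInsert φ n y)⟫_ℂ := fun φ ψ => by
    rw [symInsert, symInsert, ContinuousLinearMap.adjoint_inner_right,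
      ContinuousLinearMap.adjoint_inner_right]
  rw [key, key, symInsert_comm]

theorem norm_symInsert_le (φ : h) (n : ℕ) (x : symPow h n) :
    ‖symInsert φ n x‖ ≤ ‖φ‖ * ‖x‖ := by
  refine (symInsert φ n).le_of_opNorm_le ?_ x
  rw [symInsert, LinearIsometryEquiv.norm_map]
  exact (symContract φ n).opNorm_le_bound (norm_nonneg _) (norm_symContract_le φ n)

/-- The components of the annihilation operator. -/
def annComp (φ : h) (n : ℕ) : symPow h (n + 1) →L[ℂ] symPow h n :=
  ((√((n : ℝ) + 1) : ℝ) : ℂ) • symContract φ n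

/-- The components of the creation operator. -/
def creComp (φ : h) (n : ℕ) : symPow h n →L[ℂ] symPow h (n + 1) :=
  ((√((n : ℝ) + 1) : ℝ) : ℂ) • symInsert φ n

theorem annComp_apply (φ : h) (n : ℕ) (x : symPow h (n + 1)) :
    annComp φ n x = ((√((n : ℝ) + 1) : ℝ) : ℂ) • symContract φ n x := rfl

theorem creComp_apply (φ : h) (n : ℕ) (x : symPow h n) :
    creComp φ n x = ((√((n : ℝ) + 1) : ℝ) : ℂ) • symInsert φ n x := rfl

theorem inner_creComp (φ : h) (n : ℕ) (x : symPow h n) (y : symPow h (n + 1)) :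
    ⟪creComp φ n x, y⟫_ℂ = ⟪x, annComp φ n y⟫_ℂ := by
  refine (inner_smul_left (𝕜 := ℂ) (E := symPow h (n + 1)) _ _ _).trans ?_
  refine Eq.trans ?_ (inner_smul_right (𝕜 := ℂ) (E := symPow h n) _ _ _).symm
  rw [Complex.conj_ofReal]
  exact congrArg (_ * ·) (ContinuousLinearMap.adjoint_inner_left (symContract φ n) y x)

theorem norm_annComp_le (φ : h) (n : ℕ) (x : symPow h (n + 1)) :
    ‖annComp φ n x‖ ≤ √((n : ℝ) + 1) * ‖φ‖ * ‖x‖ := by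
  rw [annComp_apply, norm_smul, Complex.norm_real, Real.norm_of_nonneg (Real.sqrt_nonneg _),
    mul_assoc]
  exact mul_le_mul_of_nonneg_left (norm_symContract_le φ n x) (Real.sqrt_nonneg _)

theorem norm_creComp_le (φ : h) (n : ℕ) (x : symPow h n) :
    ‖creComp φ n x‖ ≤ √((n : ℝ) + 1) * ‖φ‖ * ‖x‖ := by
  rw [creComp_apply, norm_smul, Complex.norm_real, Real.norm_of_nonneg (Real.sqrt_nonneg _),
    mul_assoc]
  exact mul_le_mul_of_nonneg_left (norm_symInsert_le φ n x) (Real.sqrt_nonneg _)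

theorem ofReal_sqrt_mul_self (n : ℕ) :
    ((√((n : ℝ) + 1) : ℝ) : ℂ) * ((√((n : ℝ) + 1) : ℝ) : ℂ) = (n : ℂ) + 1 := by
  rw [← Complex.ofReal_mul, Real.mul_self_sqrt (by positivity)]
  simp

theorem annComp_creComp (φ ψ : h) (n : ℕ) (x : symPow h n) :
    annComp φ n (creComp ψ n x) = ((n : ℂ) + 1) • symContract φ n (symInsert ψ n x) := by
  rw [annComp_apply, creComp_apply, map_smul, smul_smul, ofReal_sqrt_mul_self]

theorem creComp_annComp (φ ψ : h) (n : ℕ) (x : symPow h (n + 1)) :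
    creComp ψ n (annComp φ n x) = ((n : ℂ) + 1) • symInsert ψ n (symContract φ n x) := by
  rw [annComp_apply, creComp_apply, map_smul, smul_smul, ofReal_sqrt_mul_self]

variable (h) in
/-- The finite-particle vectors, as the finitely supported vectors of a Hilbert sum. -/
abbrev FinFock : Submodule ℂ (Fock h) := finSupp fun n : ℕ => symPow h n

/-- The annihilation operator on finite-particle vectors. -/
def annFin (φ : h) : FinFock h →ₗ[ℂ] FinFock h := lower (annComp φ)

/-- The creation operator on finite-particle vectors. -/
def creFin (φ : h) : FinFock h →ₗ[ℂ] FinFock h := raise (creComp φ)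

/-- The canonical commutation relation on finite-particle vectors. -/
theorem annFin_creFin (φ ψ : h) (Ψ : FinFock h) :
    annFin φ (creFin ψ Ψ) = ⟪φ, ψ⟫_ℂ • Ψ + creFin ψ (annFin φ Ψ) := by
  refine finSupp_ext fun n => ?_
  rw [comp_add, comp_smul, annFin, creFin, comp_lower, comp_raise_succ, annComp_creComp]
  cases n with
  | zero =>
    rw [comp_raise_zero, symContract_symInsert_zero, add_zero, Nat.cast_zero, zero_add, one_smul]
  | succ n =>
    rw [comp_raise_succ, comp_lower, creComp_annComp, ← symContract_symInsert_succ]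
    congr 1
    push_cast
    ring

theorem annFin_comm (φ ψ : h) (Ψ : FinFock h) :
    annFin φ (annFin ψ Ψ) = annFin ψ (annFin φ Ψ) := by
  refine finSupp_ext fun n => ?_
  rw [annFin, annFin, comp_lower, comp_lower, comp_lower, comp_lower]
  rw [annComp_apply, annComp_apply, annComp_apply, annComp_apply, map_smul, map_smul,
    symContract_comm]

theorem creFin_comm (φ ψ : h) (Ψ : FinFock h) :
    creFin φ (creFin ψ Ψ) = creFin ψ (creFin φ Ψ) := by
  refine finSupp_ext fun n => ?_
  rw [creFin, creFin]
  cases n with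
  | zero => rw [comp_raise_zero, comp_raise_zero]
  | succ n =>
    rw [comp_raise_succ, comp_raise_succ]
    cases n with
    | zero => rw [comp_raise_zero, comp_raise_zero, map_zero, map_zero]
    | succ n =>
      rw [comp_raise_succ, comp_raise_succ, creComp_apply, creComp_apply, creComp_apply,
        creComp_apply, map_smul, map_smul, symInsert_comm]

theorem creFin_formalAdjoint (φ : h) : FormalAdjoint (V := FinFock h) (creFin φ) (annFin φ) :=
  raise_lower_formalAdjoint (inner_creComp φ)

theorem isRegular_annFin (φ : h) :
    IsRegular (V := FinFock h) (cutoff fun n : ℕ => symPow h n) (annFin φ) :=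
  isRegular_lower (norm_nonneg φ) (norm_annComp_le φ)

theorem isRegular_creFin (φ : h) :
    IsRegular (V := FinFock h) (cutoff fun n : ℕ => symPow h n) (creFin φ) :=
  isRegular_raise (norm_nonneg φ) (norm_creComp_le φ)

/-- The image under `annFin φ` is an element of ℓ² with exactly the required components, so it
carries the membership proof. -/
theorem finFock_le_annihilation (φ : h) : FinFock h ≤ (annihilation φ).domain :=
  fun Ψ hΨ => (annFin φ ⟨Ψ, hΨ⟩).1.2

theorem annihilation_finFock (φ : h) (Ψ : FinFock h) :
    annihilation φ ⟨Ψ, finFock_le_annihilation φ Ψ.2⟩ = annFin φ Ψ := rfl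

theorem dense_annihilation_domain (φ : h) : Dense ((annihilation φ).domain : Set (Fock h)) :=
  dense_finSupp.mono (finFock_le_annihilation φ)

theorem inner_creFin_annihilation (φ : h) (Ψ : FinFock h) (Φ : (annihilation φ).domain) :
    ⟪(creFin φ Ψ : Fock h), (Φ : Fock h)⟫_ℂ = ⟪(Ψ : Fock h), annihilation φ Φ⟫_ℂ :=
  inner_shift (Φ := (creFin φ Ψ).1) (X := Φ.1) (Ψ := Ψ.1) (Y := annihilation φ Φ) rfl
    fun n => inner_creComp φ n _ _

theorem inner_annihilation_creFin (φ : h) (Φ : (annihilation φ).domain) (Ψ : FinFock h) :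
    ⟪annihilation φ Φ, (Ψ : Fock h)⟫_ℂ = ⟪(Φ : Fock h), (creFin φ Ψ : Fock h)⟫_ℂ := by
  rw [← inner_conj_symm, ← inner_creFin_annihilation, inner_conj_symm]

variable [CompleteSpace h]

theorem finFock_le_creation (φ : h) : FinFock h ≤ (creation φ).domain := fun Ψ hΨ =>
  LinearPMap.mem_adjoint_domain_of_exists _ ⟨_, inner_creFin_annihilation φ ⟨Ψ, hΨ⟩⟩

theorem creation_finFock (φ : h) (Ψ : FinFock h) :
    creation φ ⟨Ψ, finFock_le_creation φ Ψ.2⟩ = creFin φ Ψ :=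
  LinearPMap.adjoint_apply_eq (dense_annihilation_domain φ) ⟨Ψ, finFock_le_creation φ Ψ.2⟩
    (inner_creFin_annihilation φ Ψ)

theorem inner_creation_annFin (φ : h) (Φ : (creation φ).domain) (Ψ : FinFock h) :
    ⟪creation φ Φ, (Ψ : Fock h)⟫_ℂ = ⟪(Φ : Fock h), (annFin φ Ψ : Fock h)⟫_ℂ :=
  LinearPMap.adjoint_isFormalAdjoint (dense_annihilation_domain φ) Φ
    ⟨Ψ, finFock_le_annihilation φ Ψ.2⟩

variable (h) in
theorem isCCRRep_fock : IsCCRRep (U := FinFock h) (fun φ ψ : h => ⟪φ, ψ⟫_ℂ)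
    (FinFock h).subtypeₗᵢ (cutoff fun n : ℕ => symPow h n) annihilation creation annFin creFin where
  denseRange := dense_finSupp.denseRange_val
  isCutoff := isCutoff_cutoff
  mem_annihilation φ Ψ := finFock_le_annihilation φ Ψ.2
  mem_creation φ Ψ := finFock_le_creation φ Ψ.2
  annihilation_apply := annihilation_finFock
  creation_apply := creation_finFock
  inner_annihilation := inner_annihilation_creFin
  inner_creation := inner_creation_annFin
  formalAdjoint := creFin_formalAdjoint
  isRegular_annihilation := isRegular_annFin
  isRegular_creation := isRegular_creFin
  annihilation_comm := annFin_comm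
  creation_comm := creFin_comm
  ccr := annFin_creFin

end BoseFock

end

theorem mainTheorem2 {h : Type*} [NormedAddCommGroup h] [InnerProductSpace ℂ h] [CompleteSpace h]
    [TopologicalSpace.SeparableSpace h] (J : h →ₗ⋆[ℂ] h) (hJ : ∀ φ : h, J (J φ) = φ)
    (hJ_inner : ∀ φ ψ : h, ⟪J φ, J ψ⟫_ℂ = ⟪ψ, φ⟫_ℂ) :
    (∀ φ : h, Dense ((BoseFock.fieldZ J φ).domain : Set (HilbertTensor (BoseFock.Fock h) (BoseFock.Fock h)))
      ∧ (BoseFock.fieldZ J φ).IsClosable) ∧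
    (∀ φ ψ : h, ∀ x ∈ BoseFock.finiteParticle₂ h,
      ∃ (h₁ : x ∈ (BoseFock.fieldZ J φ).domain)
        (h₂ : x ∈ (BoseFock.fieldZ J ψ).adjoint.domain)
        (h₃ : BoseFock.fieldZ J φ ⟨x, h₁⟩ ∈ (BoseFock.fieldZ J ψ).adjoint.domain)
        (h₄ : (BoseFock.fieldZ J ψ).adjoint ⟨x, h₂⟩ ∈ (BoseFock.fieldZ J φ).domain),
        BoseFock.fieldZ J φ ⟨_, h₄⟩ = (BoseFock.fieldZ J ψ).adjoint ⟨_, h₃⟩) ∧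
    (∀ S ∈ BoseFock.algebraZ J, ∀ T ∈ BoseFock.algebraZ J, S * T = T * S) := by
  have hR := BoseFock.isCCRRep_fock h
  have hg : ∀ φ ψ : h, ⟪J ψ, J φ⟫_ℂ = ⟪φ, ψ⟫_ℂ := fun φ ψ => hJ_inner ψ φ
  -- `fieldZ` and `finiteParticle₂` unfold to `tensorField` and to the range of `tensorIsometry` for
  -- the inclusion of `FinFock h`, so the abstract results apply by definitional equality.
  exact ⟨fun φ => ⟨(hR.hasRegularCore J φ).dense_domain, (hR.hasRegularCore J φ).isClosable⟩,
    fun φ ψ x hx => hR.tensorField_adjoint_comm hg φ ψ x hx,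
    fun S hS T hT => hR.commute_of_mem_generated hg hS hT⟩
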